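/- Let $p$ be a prime number and let $(R,\mathfrak m)$ be a Noetherian local ring of characteristic $p$ with perfect residue field. Let $I$ be an $\mathfrak m$-primary ideal of $R$ that has finite projective dimension as an $R$-module. For an integer $e\ge 0$ let $I^{[p^e]}$ denote the ideal of $R$ generated by all elements $a^{p^e}$ with $a\in I$, and let $\ell$ denote the length of an $R$-module. Then the Hilbert–Kunz function $e\mapsto \ell(R/I^{[p^e]})$ has finite values and is a polynomial in $p^e$ with rational coefficients: there is a polynomial $P\in\mathbb Q[X]$ such that $$\ell(R/I^{[p^e]})=P(p^e)\qquad\text{for all integers } e\ge 0 .$$ -/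

import Mathlib

/-- The Frobenius power `I^[p^e]`: the ideal generated by the `p^e`-th powers of all the
elements of `I`. -/
def Ideal.frobeniusPower {R : Type*} [CommRing R] (I : Ideal R) (p e : ℕ) : Ideal R :=
  Ideal.span {x : R | ∃ a ∈ I, x = a ^ p ^ e}

/-- The Hilbert-Kunz function `e ↦ ℓ(R / I^[p^e])` of the ring `R` with respect to `I`, with
values in `ℕ∞` (the length is a priori allowed to be infinite). -/
noncomputable def hilbertKunz {R : Type*} [CommRing R] (I : Ideal R) (p e : ℕ) : ℕ∞ :=
  Module.length R (R ⧸ I.frobeniusPower p e)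

-- Write `F^e_* N` for `FrobeniusPushforward p e N`. Three facts about a Noetherian local ring
-- combine.
--
-- Reduction to the `F`-finite case. The completion `S` of `R` has the same lengths `ℓ(R/I^[q])`
-- (`AdicCompletion.length_quotient_map`), and finite projective dimension survives the flat base
-- change. Since the residue field is perfect, `S` is `F`-finite (`IsFFinite.of_isAdicComplete`),
-- and `F^e_*` preserves lengths. With `J = IS`, this gives `ℓ(S/J^[p^e]) = ℓ(S/J ⊗ F^e_* S)`.
--
-- Replacing length by an Euler characteristic. A finite flat resolution of `S/J` computes Tor, and
-- `χ(N) = Σ (-1)^i ℓ(Tor_i(S/J, N))` is additive on short exact sequences of finite modules. If `s`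
-- is the last degree in which some Tor is nonzero, then `S` carries a weakly regular sequence of
-- length `s`. Such a sequence stays weakly regular on `F^e_* S`, which kills the higher Tor of
-- `F^e_* S`, as in the theorem of Peskine and Szpiro. So the length in question is `χ(F^e_* S)`.
--
-- Additive invariants of `F^e_* N` are polynomial in `p^e`. By prime filtrations it suffices to
-- treat `N = S/P`. If `r` is the rank of `F_*(S/P)` over `S/P`, then `χ(F^{e+1}_* N) = r χ(F^e_* N)
-- + χ(F^e_* T)` with `T` supported on primes strictly above `P`. The rank `r` is a power of `p` and
-- drops strictly as the prime grows (`PrimeSpectrum.frobeniusRank_lt`). Hence the recurrence has no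
-- resonance, and its solutions are combinations of geometric progressions with ratios powers of
-- `p`.

universe u v

/-! ### Frobenius pushforwards, `F`-finite rings and Frobenius powers -/

section

/-- The `e`-th Frobenius pushforward of a module: the same group, with `r` acting as `r ^ p ^ e`. -/
@[nolint unusedArguments]
def FrobeniusPushforward (_p _e : ℕ) (N : Type u) : Type u := N

namespace FrobeniusPushforward

variable (p e : ℕ) (R : Type v) [CommRing R] (N : Type u) [AddCommGroup N] [Module R N]

instance : AddCommGroup (FrobeniusPushforward p e N) := inferInstanceAs (AddCommGroup N)

/-- The identity, as an additive equivalence onto the Frobenius pushforward. -/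
def of : N ≃+ FrobeniusPushforward p e N := AddEquiv.refl N

instance [ExpChar R p] : Module R (FrobeniusPushforward p e N) :=
  Module.compHom N (iterateFrobenius R p e)

variable {R N}

@[simp]
lemma smul_of [ExpChar R p] (r : R) (x : N) : r • of p e N x = of p e N (r ^ p ^ e • x) := rfl

lemma of_symm_smul [ExpChar R p] (r : R) (x : FrobeniusPushforward p e N) :
    (of p e N).symm (r • x) = r ^ p ^ e • (of p e N).symm x := rfl

/-- The Frobenius pushforward of a linear map. -/
def map [ExpChar R p] {N' : Type*} [AddCommGroup N'] [Module R N'] (f : N →ₗ[R] N') :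
    FrobeniusPushforward p e N →ₗ[R] FrobeniusPushforward p e N' where
  toFun x := of p e N' (f ((of p e N).symm x))
  map_add' x y := by simp
  map_smul' r x := by simp [of_symm_smul]

lemma map_injective [ExpChar R p] {N' : Type*} [AddCommGroup N'] [Module R N'] {f : N →ₗ[R] N'}
    (hf : Function.Injective f) : Function.Injective (map p e f) := hf

lemma map_surjective [ExpChar R p] {N' : Type*} [AddCommGroup N'] [Module R N'] {f : N →ₗ[R] N'}
    (hf : Function.Surjective f) : Function.Surjective (map p e f) := hf

lemma map_exact [ExpChar R p] {N' N'' : Type*} [AddCommGroup N'] [Module R N']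
    [AddCommGroup N''] [Module R N''] {f : N →ₗ[R] N'} {g : N' →ₗ[R] N''}
    (hf : Function.Exact f g) : Function.Exact (map p e f) (map p e g) := hf

/-- The Frobenius pushforward of a linear equivalence. -/
noncomputable def congr [ExpChar R p] {N' : Type*} [AddCommGroup N'] [Module R N']
    (f : N ≃ₗ[R] N') :
    FrobeniusPushforward p e N ≃ₗ[R] FrobeniusPushforward p e N' :=
  LinearEquiv.ofBijective (map p e f.toLinearMap) f.bijective

variable (R N)

/-- The iterated pushforwards compose. -/
def comp [ExpChar R p] (e' : ℕ) : FrobeniusPushforward p e (FrobeniusPushforward p e' N) ≃ₗ[R]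
    FrobeniusPushforward p (e + e') N where
  __ := AddEquiv.refl N
  map_smul' r x := by
    change (r ^ p ^ e) ^ p ^ e' • (show N from x) = r ^ p ^ (e + e') • (show N from x)
    rw [← pow_mul, pow_add]

/-- The zeroth pushforward is the module. -/
def zeroEquiv [ExpChar R p] : FrobeniusPushforward p 0 N ≃ₗ[R] N where
  __ := AddEquiv.refl N
  map_smul' r x := by
    change r ^ p ^ 0 • (show N from x) = r • (show N from x)
    simp

instance [Subsingleton N] : Subsingleton (FrobeniusPushforward p e N) :=
  inferInstanceAs (Subsingleton N)

end FrobeniusPushforward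

/-- A ring of prime characteristic is `F`-finite if it is a finite module through Frobenius. -/
class IsFFinite (p : ℕ) (R : Type*) [CommRing R] [ExpChar R p] : Prop where
  finite : Module.Finite R (FrobeniusPushforward p 1 R)

namespace IsFFinite

open FrobeniusPushforward

variable (p : ℕ) (R : Type v) [CommRing R] [ExpChar R p]

/-- This elementwise form transports along ring homomorphisms without comparing module structures.
-/
lemma iff_exists_finset : IsFFinite p R ↔
    ∃ s : Finset R, ∀ x : R, ∃ c : R → R, x = ∑ a ∈ s, c a ^ p * a := by
  constructor
  · rintro ⟨⟨s, hs⟩⟩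
    refine ⟨s, fun x ↦ ?_⟩
    have : of p 1 R x ∈ Submodule.span R (s : Set (FrobeniusPushforward p 1 R)) := by
      rw [hs]; trivial
    obtain ⟨c, hc⟩ := Submodule.mem_span_finset.mp this
    refine ⟨c, ?_⟩
    rw [← (of p 1 R).symm_apply_apply x, ← hc.2, map_sum]
    refine Finset.sum_congr rfl fun a _ ↦ ?_
    rw [of_symm_smul, pow_one]; rfl
  · rintro ⟨s, hs⟩
    refine ⟨⟨s, eq_top_iff.mpr fun x _ ↦ ?_⟩⟩
    obtain ⟨c, hc⟩ := hs ((of p 1 R).symm x)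
    have : x = ∑ a ∈ s, c a • of p 1 R a := by
      apply (of p 1 R).symm.injective
      rw [hc, map_sum]
      refine Finset.sum_congr rfl fun a _ ↦ ?_
      rw [of_symm_smul, pow_one]; rfl
    rw [this]
    exact Submodule.sum_mem _ fun a ha ↦ Submodule.smul_mem _ _ (Submodule.subset_span ha)

variable {R}

lemma of_surjective {R' : Type*} [CommRing R'] [ExpChar R' p] [h : IsFFinite p R] (f : R →+* R')
    (hf : Function.Surjective f) : IsFFinite p R' := by
  classical
  obtain ⟨s, hs⟩ := (iff_exists_finset p R).mp h
  refine ⟨⟨s.image f, eq_top_iff.mpr fun x _ ↦ ?_⟩⟩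
  obtain ⟨y, hy⟩ := hf ((of p 1 R').symm x)
  obtain ⟨c, hc⟩ := hs y
  have : x = ∑ a ∈ s, f (c a) • of p 1 R' (f a) := by
    apply (of p 1 R').symm.injective
    rw [← hy, hc, map_sum, map_sum]
    refine Finset.sum_congr rfl fun a _ ↦ ?_
    rw [of_symm_smul, pow_one, map_mul, map_pow]; rfl
  rw [this]
  exact Submodule.sum_mem _ fun a ha ↦ Submodule.smul_mem _ _
    (Submodule.subset_span (Finset.mem_coe.mpr (Finset.mem_image_of_mem f ha)))

lemma of_isLocalization (M : Submonoid R) (R' : Type*) [CommRing R'] [ExpChar R' p] [Algebra R R']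
    [IsLocalization M R'] [h : IsFFinite p R] : IsFFinite p R' := by
  classical
  obtain ⟨s, hs⟩ := (iff_exists_finset p R).mp h
  have hp : p ≠ 0 := (expChar_pos R p).ne'
  refine ⟨⟨s.image (algebraMap R R'), eq_top_iff.mpr fun x _ ↦ ?_⟩⟩
  obtain ⟨a, b, hab⟩ := IsLocalization.exists_mk'_eq M ((of p 1 R').symm x)
  -- The fraction `a / b` equals `a b^(p-1) / b^p`, whose denominator is a `p`-th power and can be
  -- absorbed into the coefficients.
  obtain ⟨c, hc⟩ := hs (a * b ^ (p - 1))
  have : x = ∑ i ∈ s, IsLocalization.mk' R' (c i) b • of p 1 R' (algebraMap R R' i) := by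
    apply (of p 1 R').symm.injective
    rw [map_sum]
    simp_rw [of_symm_smul, AddEquiv.symm_apply_apply, smul_eq_mul, pow_one]
    apply (IsLocalization.map_units R' (b ^ p)).mul_right_cancel
    rw [Finset.sum_mul]
    have h1 (i : R) : IsLocalization.mk' R' (c i) b ^ p * algebraMap R R' i *
        algebraMap R R' (b ^ p : M) = algebraMap R R' (c i ^ p * i) := by
      rw [mul_right_comm, SubmonoidClass.coe_pow, map_pow, ← mul_pow, IsLocalization.mk'_spec,
        map_mul, map_pow]
    simp_rw [h1]
    rw [← map_sum, ← hc, ← hab, SubmonoidClass.coe_pow,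
      show (b : R) ^ p = b * b ^ (p - 1) by rw [← pow_succ', Nat.sub_add_cancel (by lia)],
      map_mul, ← mul_assoc, IsLocalization.mk'_spec, map_mul]
  rw [this]
  exact Submodule.sum_mem _ fun a ha ↦ Submodule.smul_mem _ _
    (Submodule.subset_span (Finset.mem_coe.mpr (Finset.mem_image_of_mem _ ha)))

/-- Frobenius pushforwards of finite modules over an `F`-finite ring are finite. -/
lemma finite_pushforward [h : IsFFinite p R] (N : Type*) [AddCommGroup N] [Module R N]
    [Module.Finite R N] (e : ℕ) : Module.Finite R (FrobeniusPushforward p e N) := by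
  have key (N : Type _) [AddCommGroup N] [Module R N] [Module.Finite R N] :
      Module.Finite R (FrobeniusPushforward p 1 N) := by
    have := h.finite
    obtain ⟨n, f, hf⟩ := Module.Finite.exists_fin' R N
    let g : (Fin n → FrobeniusPushforward p 1 R) →ₗ[R] FrobeniusPushforward p 1 (Fin n → R) :=
      { toFun := fun x ↦ of p 1 (Fin n → R) fun i ↦ (of p 1 R).symm (x i)
        map_add' := fun x y ↦ rfl
        map_smul' := fun r x ↦ rfl }
    refine Module.Finite.of_surjective ((map p 1 f).comp g) ((map_surjective p 1 hf).comp ?_)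
    exact fun y ↦ ⟨fun i ↦ of p 1 R ((of p 1 (Fin n → R)).symm y i), rfl⟩
  induction e with
  | zero => exact Module.Finite.equiv (zeroEquiv p R N).symm
  | succ e ih =>
    rw [add_comm]
    exact Module.Finite.equiv (comp p 1 R N e)

end IsFFinite

namespace Ideal

variable {R : Type*} [CommRing R] (I : Ideal R) (p e : ℕ)

lemma frobeniusPower_eq_map [ExpChar R p] :
    I.frobeniusPower p e = I.map (iterateFrobenius R p e) := by
  rw [frobeniusPower, Ideal.map]
  congr 1
  ext x
  simp [iterateFrobenius_def, eq_comm]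

lemma pow_mem_frobeniusPower {x : R} (hx : x ∈ I) : x ^ p ^ e ∈ I.frobeniusPower p e :=
  Ideal.subset_span ⟨x, hx, rfl⟩

lemma frobeniusPower_le_pow : I.frobeniusPower p e ≤ I ^ p ^ e := by
  rw [frobeniusPower, Ideal.span_le]
  rintro _ ⟨a, ha, rfl⟩
  exact Ideal.pow_mem_pow ha _

lemma frobeniusPower_frobeniusPower [ExpChar R p] (e' : ℕ) :
    (I.frobeniusPower p e).frobeniusPower p e' = I.frobeniusPower p (e' + e) := by
  simp only [frobeniusPower_eq_map, Ideal.map_map]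
  rw [iterateFrobenius_add]

lemma frobeniusPower_map [ExpChar R p] {R' : Type*} [CommRing R'] [ExpChar R' p] (f : R →+* R') :
    (I.map f).frobeniusPower p e = (I.frobeniusPower p e).map f := by
  simp only [frobeniusPower_eq_map, Ideal.map_map]
  congr 1
  ext x
  simp [iterateFrobenius_def]

lemma exists_pow_le_frobeniusPower [IsNoetherianRing R] [ExpChar R p] {m : Ideal R}
    (h : m ≤ I.radical) : ∃ k, m ^ k ≤ I.frobeniusPower p e := by
  apply Ideal.exists_pow_le_of_le_radical_of_fg _ (IsNoetherian.noetherian _)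
  intro x hx
  obtain ⟨n, hn⟩ := h hx
  exact ⟨n * p ^ e, by rw [pow_mul]; exact pow_mem_frobeniusPower I p e hn⟩

end Ideal

end

/-! ### Lengths of pushforwards; complete local rings with perfect residue field are `F`-finite -/

section

open IsLocalRing

namespace FrobeniusPushforward

variable (p : ℕ) (R : Type u) [CommRing R] [IsLocalRing R] [ExpChar R p]

/-- The length of the Frobenius pushforward of the residue field. -/
noncomputable def residueLength : ℕ∞ :=
  Module.length R (FrobeniusPushforward p 1 (ResidueField R))

/-- The pushforward is exact, so each composition factor of `N`, being a copy of the residue field,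
contributes the same amount. -/
lemma length_eq_residueLength_mul {N : Type*} [AddCommGroup N] [Module R N]
    (hN : IsFiniteLength R N) :
    Module.length R (FrobeniusPushforward p 1 N) = residueLength p R * Module.length R N := by
  induction hN with
  | of_subsingleton => simp [Module.length_eq_zero]
  | @of_simple_quotient M _ _ N hs hfin ih =>
    rw [Module.length_eq_add_of_exact (FrobeniusPushforward.map p 1 N.subtype)
      (FrobeniusPushforward.map p 1 N.mkQ) (map_injective p 1 N.injective_subtype)
      (map_surjective p 1 N.mkQ_surjective) (map_exact p 1 (LinearMap.exact_subtype_mkQ N)),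
      Module.length_eq_add_of_exact N.subtype N.mkQ N.injective_subtype N.mkQ_surjective
      (LinearMap.exact_subtype_mkQ N), ih, mul_add]
    congr 1
    have hs' := hs
    obtain ⟨m, hm, ⟨e⟩⟩ := isSimpleModule_iff_quot_maximal.mp hs
    obtain rfl := IsLocalRing.eq_maximalIdeal hm
    rw [Module.length_eq_one (R := R) (M := M ⧸ N), mul_one]
    exact (FrobeniusPushforward.congr p 1 e).length_eq

/-- When `x ≠ 0`, the quotient `y / x` is a `p`-th power in a perfect field, so every nonzero
element generates the pushforward. -/
lemma residueLength_eq_one [Fact p.Prime] [CharP R p] [PerfectField (ResidueField R)] :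
    residueLength p R = 1 := by
  have : CharP (ResidueField R) p := by
    refine (CharP.charP_iff_prime_eq_zero (Fact.out (p := p.Prime))).mpr ?_
    rw [← map_natCast (residue R), CharP.cast_eq_zero, map_zero]
  rw [residueLength, Module.length_eq_one_iff]
  have : Nontrivial (FrobeniusPushforward p 1 (ResidueField R)) :=
    inferInstanceAs (Nontrivial (ResidueField R))
  rw [isSimpleModule_iff_toSpanSingleton_surjective]
  refine ⟨inferInstance, fun x hx y ↦ ?_⟩
  have : ExpChar (ResidueField R) p := .prime Fact.out
  have : PerfectRing (ResidueField R) p := inferInstance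
  obtain ⟨c, hc⟩ := (PerfectRing.bijective_frobenius (R := ResidueField R) (p := p)).2
    ((of p 1 _).symm y / (of p 1 _).symm x)
  obtain ⟨r, rfl⟩ := residue_surjective c
  refine ⟨r, ?_⟩
  apply (of p 1 (ResidueField R)).symm.injective
  rw [LinearMap.toSpanSingleton_apply, of_symm_smul, pow_one, Algebra.smul_def, map_pow]
  change residue R r ^ p * _ = _
  rw [show residue R r ^ p = _ from hc, div_mul_cancel₀]
  exact hx

lemma length_eq [Fact p.Prime] [CharP R p] [PerfectField (ResidueField R)] (e : ℕ)
    {N : Type*} [AddCommGroup N] [Module R N] (hN : IsFiniteLength R N) :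
    Module.length R (FrobeniusPushforward p e N) = Module.length R N := by
  induction e with
  | zero => exact (zeroEquiv p R N).length_eq
  | succ e ih =>
    rw [add_comm, ← (comp p 1 R N e).length_eq, length_eq_residueLength_mul, residueLength_eq_one,
      one_mul, ih]
    rw [← Module.length_ne_top_iff] at hN ⊢
    rwa [ih]

end FrobeniusPushforward

lemma isFiniteLength_quotient_of_pow_le {R : Type*} [CommRing R] [IsLocalRing R]
    [IsNoetherianRing R] {J : Ideal R} {k : ℕ} (h : maximalIdeal R ^ k ≤ J) :
    IsFiniteLength R (R ⧸ J) := by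
  rw [isFiniteLength_iff_isNoetherian_isArtinian]
  refine ⟨inferInstance, ?_⟩
  by_cases hJ : J = ⊤
  · have : Subsingleton (R ⧸ J) := Ideal.Quotient.subsingleton_iff.mpr hJ
    infer_instance
  have : Nontrivial (R ⧸ J) := Ideal.Quotient.nontrivial_iff.mpr hJ
  have hA : IsArtinianRing (R ⧸ J) := by
    have : IsLocalRing (R ⧸ J) :=
      IsLocalRing.of_surjective' (Ideal.Quotient.mk J) Ideal.Quotient.mk_surjective
    rw [isArtinianRing_iff_isNilpotent_maximalIdeal]
    refine ⟨k, ?_⟩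
    have hle : maximalIdeal (R ⧸ J) ≤ (maximalIdeal R).map (Ideal.Quotient.mk J) := by
      rw [← Ideal.map_comap_of_surjective _ Ideal.Quotient.mk_surjective (maximalIdeal (R ⧸ J))]
      exact Ideal.map_mono (IsLocalRing.le_maximalIdeal
        (Ideal.comap_ne_top _ (Ideal.IsPrime.ne_top inferInstance)))
    rw [Ideal.zero_eq_bot, eq_bot_iff]
    refine (Ideal.pow_right_mono hle k).trans ?_
    rw [← Ideal.map_pow, Ideal.map_le_iff_le_comap]
    exact h.trans (by rw [← RingHom.ker_eq_comap_bot, Ideal.mk_ker])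
  exact isArtinian_of_surjective_algebraMap (R := R ⧸ J) Ideal.Quotient.mk_surjective

section Complete

variable {R : Type u} [CommRing R] (I : Ideal R)

/-- The completion of a finite `M` is a quotient of `R^ ⊗ M`, and every element of `R^` comes from
`R`. -/
lemma IsPrecomplete.of_finite [IsPrecomplete I R] (M : Type*) [AddCommGroup M] [Module R M]
    [Module.Finite R M] : IsPrecomplete I M := by
  rw [← AdicCompletion.of_surjective_iff]
  intro x
  obtain ⟨t, rfl⟩ := AdicCompletion.ofTensorProduct_surjective_of_finite I M x
  induction t with
  | zero => exact ⟨0, by simp⟩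
  | add a b ha hb =>
    obtain ⟨a', ha'⟩ := ha
    obtain ⟨b', hb'⟩ := hb
    exact ⟨a' + b', by rw [map_add, map_add, ha', hb']⟩
  | tmul r m =>
    obtain ⟨r, rfl⟩ := AdicCompletion.of_surjective I R r
    refine ⟨r • m, ?_⟩
    rw [AdicCompletion.ofTensorProduct_tmul]
    ext n
    rfl

/-- A separated module over a complete ring is finite if it is finite modulo the ideal. -/
lemma Module.Finite.of_isPrecomplete [IsPrecomplete I R] (N : Type*) [AddCommGroup N] [Module R N]
    [IsHausdorff I N] (h : Module.Finite R (N ⧸ (I • ⊤ : Submodule R N))) : Module.Finite R N := by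
  obtain ⟨n, f, hf⟩ := Module.Finite.exists_fin' R (N ⧸ (I • ⊤ : Submodule R N))
  obtain ⟨g, hg⟩ := Module.projective_lifting_property (I • ⊤ : Submodule R N).mkQ f
    (Submodule.mkQ_surjective _)
  have := IsPrecomplete.of_finite I (Fin n → R)
  exact Module.Finite.of_surjective g
    (surjective_of_mkQ_comp_surjective (I := I) (by rw [hg]; exact hf))

end Complete

-- Nakayama's lemma over a complete ring: `F_* R` is separated, and `F_* R / m F_* R` is a quotient
-- of `F_*(R / m^[p])`, which has finite length because `F_*` preserves lengths.
open FrobeniusPushforward in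
lemma IsFFinite.of_isAdicComplete (p : ℕ) [Fact p.Prime] (R : Type u) [CommRing R] [IsLocalRing R]
    [IsNoetherianRing R] [CharP R p] [ExpChar R p] [PerfectField (ResidueField R)]
    [IsAdicComplete (maximalIdeal R) R] : IsFFinite p R := by
  have hHaus : IsHausdorff (maximalIdeal R) (FrobeniusPushforward p 1 R) := by
    refine ⟨fun x hx ↦ ?_⟩
    apply (of p 1 R).symm.injective
    rw [map_zero]
    refine IsHausdorff.haus (inferInstance : IsHausdorff (maximalIdeal R) R) _ fun n ↦ ?_
    have := hx n
    rw [SModEq.zero] at this ⊢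
    rw [smul_eq_mul, Ideal.mul_top]
    refine Submodule.smul_induction_on (p := fun x ↦ (of p 1 R).symm x ∈ maximalIdeal R ^ n) this
      (fun r hr y _ ↦ ?_) fun x y hx hy ↦ ?_
    · rw [of_symm_smul]
      exact Ideal.mul_mem_right _ _ (Ideal.pow_mem_of_mem _ hr _ (by
        have := (Fact.out : p.Prime).pos; positivity))
    · rw [map_add]; exact add_mem hx hy
  refine ⟨Module.Finite.of_isPrecomplete (maximalIdeal R) _ ?_⟩
  obtain ⟨k, hk⟩ := (maximalIdeal R).exists_pow_le_frobeniusPower p 1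
    (m := maximalIdeal R) Ideal.le_radical
  have hfl := isFiniteLength_quotient_of_pow_le hk
  have hfl' : IsFiniteLength R (FrobeniusPushforward p 1
      (R ⧸ (maximalIdeal R).frobeniusPower p 1)) := by
    rw [← Module.length_ne_top_iff] at hfl ⊢
    rwa [FrobeniusPushforward.length_eq p R 1 (Module.length_ne_top_iff.mp hfl)]
  rw [isFiniteLength_iff_isNoetherian_isArtinian] at hfl'
  have := hfl'.1
  let f := map p 1 (Submodule.mkQ ((maximalIdeal R).frobeniusPower p 1))
  have hker : LinearMap.ker f ≤
      (maximalIdeal R • ⊤ : Submodule R (FrobeniusPushforward p 1 R)) := by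
    intro x hx
    have hx' : (of p 1 R).symm x ∈ (maximalIdeal R).frobeniusPower p 1 := by
      have : Submodule.mkQ ((maximalIdeal R).frobeniusPower p 1) ((of p 1 R).symm x) = 0 := hx
      exact (Submodule.Quotient.mk_eq_zero _).mp this
    rw [← (of p 1 R).apply_symm_apply x]
    refine Submodule.span_induction (p := fun y _ ↦ of p 1 R y ∈
      (maximalIdeal R • ⊤ : Submodule R (FrobeniusPushforward p 1 R))) ?_ ?_ ?_ ?_ hx'
    · rintro _ ⟨a, ha, rfl⟩
      have : of p 1 R (a ^ p ^ 1) = a • of p 1 R 1 := by simp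
      rw [this]
      exact Submodule.smul_mem_smul ha trivial
    · simp
    · intro x y _ _ hx hy
      rw [map_add]; exact add_mem hx hy
    -- The ordinary multiplication by `a` commutes with the twisted action, so it preserves `m F_*
    -- R`.
    · intro a x _ hx
      let g : R →+ FrobeniusPushforward p 1 R := (of p 1 R).toAddMonoidHom
      refine Submodule.smul_induction_on
        (p := fun y ↦ of p 1 R (a • (of p 1 R).symm y) ∈
          (maximalIdeal R • ⊤ : Submodule R (FrobeniusPushforward p 1 R))) hx ?_ ?_
      · intro r hr n _
        rw [of_symm_smul, smul_comm a, ← smul_of]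
        exact Submodule.smul_mem_smul hr trivial
      · intro x y hx hy
        rw [map_add, smul_add, map_add]; exact add_mem hx hy
  let e := f.quotKerEquivOfSurjective (map_surjective p 1 (Submodule.mkQ_surjective _))
  have : Module.Finite R (FrobeniusPushforward p 1 R ⧸ LinearMap.ker f) :=
    Module.Finite.equiv e.symm
  exact Module.Finite.of_surjective (Submodule.factor hker) (Submodule.factor_surjective hker)

end

/-! ### Adic completion of a Noetherian local ring -/

section

open IsLocalRing

namespace AdicCompletion

variable {R : Type u} [CommRing R]

/-- The adic completion of a Noetherian ring is Noetherian. -/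
instance isNoetherianRing_self [IsNoetherianRing R] (I : Ideal R) :
    IsNoetherianRing (AdicCompletion I R) := by
  obtain ⟨s, hs⟩ := IsNoetherian.noetherian I
  let A := AdicCompletion I R
  let J : Ideal A := I.map (algebraMap R A)
  have hJ : IsAdicComplete J A := isAdicComplete_self I (IsNoetherian.noetherian I)
  -- With `R` discrete and `A` carrying its `J`-adic topology, power series over `R` can be
  -- evaluated at generators of `I`. The completion is then a quotient of a power series ring in
  -- finitely many variables.
  let : UniformSpace R := ⊥
  have : DiscreteUniformity R := ⟨rfl⟩
  let : WithIdeal A := ⟨J⟩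
  have hadic : IsAdic J := rfl
  have hc := hadic.isAdicComplete_iff.mp hJ
  have := hc.1
  have := hc.2
  have hlin : IsLinearTopology A A := by
    rw [isLinearTopology_iff_hasBasis_ideal]
    refine hadic.hasBasis_nhds_zero.to_hasBasis (fun n _ ↦ ⟨J ^ n, ?_, le_rfl⟩)
      fun K hK ↦ ?_
    · exact hadic.hasBasis_nhds_zero.mem_of_mem trivial
    · obtain ⟨n, _, hn⟩ := hadic.hasBasis_nhds_zero.mem_iff.mp hK
      exact ⟨n, trivial, hn⟩
  have : ContinuousSMul R A := DiscreteTopology.instContinuousSMul R A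
  let a : s → A := fun x ↦ algebraMap R A x
  have ha (x : s) : a x ∈ J := Ideal.mem_map_of_mem _ (by
    rw [← hs]; exact Ideal.subset_span x.2)
  have hE : MvPowerSeries.HasEval a := by
    refine ⟨fun x ↦ ?_, ?_⟩
    · refine hadic.hasBasis_nhds_zero.tendsto_right_iff.mpr fun n _ ↦ ?_
      filter_upwards [Filter.eventually_ge_atTop n] with m hm
      exact Ideal.pow_le_pow_right hm (Ideal.pow_mem_pow (ha x) m)
    · rw [Filter.cofinite_eq_bot]
      exact Filter.tendsto_bot
  let f := MvPowerSeries.aeval (R := R) hE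
  let X : Ideal (MvPowerSeries s R) := Ideal.span (Set.range MvPowerSeries.X)
  have hX (x : s) : f (MvPowerSeries.X x) = a x := by
    rw [← MvPolynomial.coe_X, MvPowerSeries.aeval_coe, MvPolynomial.aeval_X]
  have hXJ : X.map f.toRingHom = J := by
    apply le_antisymm
    · rw [Ideal.map_span, Ideal.span_le]
      rintro _ ⟨_, ⟨x, rfl⟩, rfl⟩
      change f _ ∈ J
      rw [hX]; exact ha x
    · rw [Ideal.map_le_iff_le_comap]
      refine hs.symm.le.trans (Submodule.span_le.mpr ?_)
      intro x hx
      have := Ideal.mem_map_of_mem f.toRingHom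
        (Ideal.subset_span (Set.mem_range_self (⟨x, hx⟩ : s)) : MvPowerSeries.X _ ∈ X)
      change f _ ∈ _ at this
      rw [hX] at this
      exact this
  have hHaus : IsHausdorff (X.map f.toRingHom) A := by rw [hXJ]; infer_instance
  -- By completeness, surjectivity need only be checked modulo the variables, where constants from
  -- `R` suffice.
  refine isNoetherianRing_of_surjective (MvPowerSeries s R) A f.toRingHom
    (surjective_of_mk_map_comp_surjective (I := X) f.toRingHom ?_)
  intro y
  obtain ⟨y, rfl⟩ := Ideal.Quotient.mk_surjective y
  obtain ⟨r, hr⟩ := Ideal.Quotient.mk_surjective (evalOneₐ I y)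
  refine ⟨algebraMap R _ r, ?_⟩
  change Ideal.Quotient.mk _ (f (algebraMap R _ r)) = _
  rw [AlgHom.commutes, Ideal.Quotient.eq, hXJ]
  change _ ∈ I.map (algebraMap R A)
  rw [← ker_evalOneₐ_eq_map I (IsNoetherian.noetherian I), RingHom.mem_ker, map_sub, sub_eq_zero]
  change evalOneₐ I (algebraMap R A r) = evalOneₐ I y
  rw [← hr]
  exact (evalOneₐ I).commutes r

variable (R) in
lemma perfectField_residueField [IsLocalRing R] [IsNoetherianRing R]
    [PerfectField (ResidueField R)] :
    PerfectField (ResidueField (AdicCompletion (maximalIdeal R) R)) :=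
  PerfectField.of_ringEquiv (RingEquiv.ofBijective _ (residueField_map_bijective R))

lemma charP_self [IsLocalRing R] [IsNoetherianRing R] (p : ℕ) [CharP R p] :
    CharP (AdicCompletion (maximalIdeal R) R) p :=
  charP_of_injective_algebraMap (A := AdicCompletion (maximalIdeal R) R) (by
    have : Module.FaithfullyFlat R (AdicCompletion (maximalIdeal R) R) :=
      Module.FaithfullyFlat.of_flat_of_isLocalHom
    exact FaithfulSMul.algebraMap_injective R (AdicCompletion (maximalIdeal R) R)) p

/-- Because `J` contains `I ^ k`, the quotient is already seen at level `k` of the completion, where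
`R` and its completion agree. Both rings surject onto the common quotient, so they see the same
submodules. -/
lemma length_quotient_map {I : Ideal R} [IsNoetherianRing R] {J : Ideal R} {k : ℕ}
    (hk : I ^ k ≤ J) :
    Module.length (AdicCompletion I R)
      (AdicCompletion I R ⧸ J.map (algebraMap R (AdicCompletion I R))) =
    Module.length R (R ⧸ J) := by
  let A := AdicCompletion I R
  let JA := J.map (algebraMap R A)
  have hIk : (I ^ k).map (algebraMap R A) ≤ JA := Ideal.map_mono hk
  have hev (y : A) (hy : eval I R k y = 0) : y ∈ JA := by
    apply hIk
    have h1 : y ∈ LinearMap.ker (eval I R k) := hy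
    rw [← pow_smul_top_eq_ker_eval (IsNoetherian.noetherian I), Ideal.smul_top_eq_map] at h1
    exact h1
  let φ : R ⧸ J →+* A ⧸ JA := Ideal.quotientMap JA (algebraMap R A) Ideal.le_comap_map
  have hφ : Function.Bijective φ := by
    constructor
    · apply Ideal.quotientMap_injective'
      intro x hx
      have hx' : algebraMap R A x ∈ JA := hx
      let ψ : A →ₐ[R] R ⧸ I ^ k := evalₐ I k
      have h2 : JA ≤ (J.map (Ideal.Quotient.mk (I ^ k))).comap ψ := by
        rw [Ideal.map_le_iff_le_comap]
        intro y hy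
        rw [Ideal.mem_comap, Ideal.mem_comap, AlgHom.commutes]
        exact Ideal.mem_map_of_mem _ hy
      have h3 := h2 hx'
      rw [Ideal.mem_comap, AlgHom.commutes] at h3
      have h4 := (Ideal.mem_quotient_iff_mem hk).mp h3
      exact h4
    · intro y
      obtain ⟨y, rfl⟩ := Ideal.Quotient.mk_surjective y
      obtain ⟨r, hr⟩ := Submodule.Quotient.mk_surjective _ (eval I R k y)
      refine ⟨Ideal.Quotient.mk J r, ?_⟩
      rw [Ideal.quotientMap_mk, Ideal.Quotient.eq]
      apply hev
      rw [map_sub, sub_eq_zero, ← hr]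
      rfl
  let e : (R ⧸ J) ≃ₗ[R] (A ⧸ JA) := LinearEquiv.ofBijective
    ({ toFun := φ
       map_add' := map_add φ
       map_smul' := fun r x ↦ by
        change φ (r • x) = r • φ x
        rw [Algebra.smul_def, Algebra.smul_def, map_mul]; rfl } : (R ⧸ J) →ₗ[R] (A ⧸ JA)) hφ
  rw [e.length_eq]
  have hs1 : Function.Surjective (algebraMap A (A ⧸ JA)) := Ideal.Quotient.mk_surjective
  have hs2 : Function.Surjective (algebraMap R (A ⧸ JA)) := by
    intro y
    obtain ⟨x, rfl⟩ := hφ.2 y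
    obtain ⟨r, rfl⟩ := Ideal.Quotient.mk_surjective x
    exact ⟨r, rfl⟩
  exact (Module.length_eq_of_surjective (M := A ⧸ JA) hs1).trans
    (Module.length_eq_of_surjective (M := A ⧸ JA) hs2).symm

end AdicCompletion

end

/-! ### Ranks of Frobenius and estimates of length -/

section

open IsLocalRing Module

open FrobeniusPushforward

/-- The rank of a ring as a module over itself through Frobenius. -/
noncomputable def frobeniusRank (p : ℕ) (R : Type u) [CommRing R] [ExpChar R p] : ℕ :=
  finrank R (FrobeniusPushforward p 1 R)

lemma frobeniusRank_eq_of_ringEquiv (p : ℕ) {R : Type u} {R' : Type v} [CommRing R] [CommRing R']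
    [ExpChar R p] [ExpChar R' p] (f : R ≃+* R') : frobeniusRank p R = frobeniusRank p R' := by
  have h := lift_rank_eq_of_equiv_equiv (M := FrobeniusPushforward p 1 R)
    (M' := FrobeniusPushforward p 1 R') f
    (show FrobeniusPushforward p 1 R ≃+ FrobeniusPushforward p 1 R' from f.toAddEquiv) f.bijective
    (fun r x ↦ by
      change f (r ^ p ^ 1 * (show R from x)) = (f r) ^ p ^ 1 * f (show R from x)
      rw [map_mul, map_pow])
  simpa [frobeniusRank, finrank] using congrArg Cardinal.toNat h

/-- The pushforward of `R'` is the localization of the pushforward of `R`, again because `a / b = a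
b^(p-1) / b^p`. -/
lemma frobeniusRank_eq_of_isLocalization (p : ℕ) (R : Type u) [CommRing R] [ExpChar R p]
    (M : Submonoid R) (hM : M ≤ nonZeroDivisors R) (R' : Type v) [CommRing R'] [ExpChar R' p]
    [Algebra R R'] [IsLocalization M R'] : frobeniusRank p R' = frobeniusRank p R := by
  have hp : 0 < p := expChar_pos R p
  have : IsScalarTower R R' (FrobeniusPushforward p 1 R') := ⟨fun a b x ↦ by
    apply (of p 1 R').symm.injective
    change (a • b) ^ p ^ 1 * (of p 1 R').symm x = a ^ p ^ 1 • (b ^ p ^ 1 * (of p 1 R').symm x)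
    rw [Algebra.smul_def, Algebra.smul_def, mul_pow, map_pow, mul_assoc]⟩
  have hloc : IsLocalizedModule M (FrobeniusPushforward.map p 1 (Algebra.linearMap R R')) := by
    refine ⟨fun s ↦ ?_, fun y ↦ ?_, fun {x y} h ↦ ?_⟩
    · rw [Module.End.isUnit_iff]
      have hu : IsUnit (algebraMap R R' ((s : R) ^ p ^ 1)) := by
        rw [map_pow]; exact (IsLocalization.map_units R' s).pow _
      obtain ⟨u, hu⟩ := hu
      have h1 : ∀ x : FrobeniusPushforward p 1 R', (of p 1 R').symm ((s : R) • x) =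
          u * (of p 1 R').symm x := fun x ↦ by
        rw [of_symm_smul, Algebra.smul_def, hu]
      constructor
      · intro x y hxy
        apply (of p 1 R').symm.injective
        have := congrArg (of p 1 R').symm
          (show (s : R) • x = (s : R) • y from hxy)
        rw [h1, h1] at this
        exact u.isUnit.mul_left_cancel this
      · intro y
        refine ⟨of p 1 R' (↑u⁻¹ * (of p 1 R').symm y), ?_⟩
        apply (of p 1 R').symm.injective
        refine (h1 _).trans ?_
        simp
    · obtain ⟨a, b, hab⟩ := IsLocalization.exists_mk'_eq M ((of p 1 R').symm y)
      refine ⟨⟨of p 1 R (a * b ^ (p - 1)), b⟩, ?_⟩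
      apply (of p 1 R').symm.injective
      change (b : R) ^ p ^ 1 • (of p 1 R').symm y = algebraMap R R' (a * b ^ (p - 1))
      rw [← hab, Algebra.smul_def, pow_one,
        show (b : R) ^ p = b * b ^ (p - 1) by rw [← pow_succ', Nat.sub_add_cancel (by lia)],
        map_mul, mul_right_comm, mul_comm (algebraMap R R' b), IsLocalization.mk'_spec, map_mul]
    · refine ⟨1, ?_⟩
      rw [show x = y from IsLocalization.injective R' hM h]
  rw [frobeniusRank, frobeniusRank, IsLocalization.finrank_eq R' M hM,
    IsLocalizedModule.finrank_eq M (FrobeniusPushforward.map p 1 (Algebra.linearMap R R')) hM]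

/-- Viewed through Frobenius, `K` is a finite purely inseparable extension of itself. -/
lemma exists_frobeniusRank_field_eq_pow (p : ℕ) (K : Type u) [Field K] [ExpChar K p]
    [h : IsFFinite p K] : ∃ i, frobeniusRank p K = p ^ i := by
  let : Field (FrobeniusPushforward p 1 K) := inferInstanceAs (Field K)
  let alg : Algebra K (FrobeniusPushforward p 1 K) :=
    { (inferInstance : Module K (FrobeniusPushforward p 1 K)) with
      algebraMap := iterateFrobenius K p 1
      commutes' := fun r x ↦ mul_comm _ _
      smul_def' := fun r x ↦ rfl }
  have : IsPurelyInseparable K (FrobeniusPushforward p 1 K) := by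
    rw [isPurelyInseparable_iff_pow_mem K p]
    exact fun x ↦ ⟨1, (of p 1 K).symm x, rfl⟩
  have : @FiniteDimensional K (FrobeniusPushforward p 1 K) _ _ alg.toModule := h.finite
  exact IsPurelyInseparable.finrank_eq_pow (F := K) (FrobeniusPushforward p 1 K) p

lemma exists_frobeniusRank_eq_pow (p : ℕ) (A : Type u) [CommRing A] [IsDomain A] [ExpChar A p]
    [IsFFinite p A] : ∃ i, frobeniusRank p A = p ^ i := by
  have : ExpChar (FractionRing A) p := expChar_of_injective_algebraMap
    (IsFractionRing.injective A (FractionRing A)) p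
  have := IsFFinite.of_isLocalization p (nonZeroDivisors A) (FractionRing A)
  rw [← frobeniusRank_eq_of_isLocalization p A (nonZeroDivisors A) le_rfl (FractionRing A)]
  exact exists_frobeniusRank_field_eq_pow p _

/-- A finite module over a domain contains a free submodule with torsion quotient. -/
lemma exists_linearIndependent_smul_mem_span (A : Type u) [CommRing A] [IsDomain A]
    (N : Type v) [AddCommGroup N] [Module A N] [Module.Finite A N] :
    ∃ v : Fin (finrank A N) → N, LinearIndependent A v ∧
      ∃ s : A, s ≠ 0 ∧ ∀ x : N, s • x ∈ Submodule.span A (Set.range v) := by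
  obtain ⟨t, ht, hli⟩ := exists_set_linearIndependent_of_isDomain A N
  have hcard : Cardinal.mk t = finrank A N := by rw [ht, finrank_eq_rank]
  have : Fintype t := (Cardinal.lt_aleph0_iff_fintype.mp
    (hcard ▸ Cardinal.natCast_lt_aleph0)).some
  have hc : Fintype.card t = finrank A N := by
    rw [Cardinal.mk_fintype] at hcard; exact_mod_cast hcard
  let e : Fin (finrank A N) ≃ t := (Fintype.equivFinOfCardEq hc).symm
  let v : Fin (finrank A N) → N := fun i ↦ e i
  have hv : LinearIndependent A v := hli.comp e e.injective
  refine ⟨v, hv, ?_⟩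
  have hspan : Module.rank A (Submodule.span A (Set.range v)) = finrank A N := by
    have := Module.Finite.span_of_finite A (Set.finite_range v)
    rw [← finrank_eq_rank, finrank_span_eq_card hv, Fintype.card_fin]
  have h0 : finrank A (N ⧸ Submodule.span A (Set.range v)) = 0 := by
    have := rank_quotient_add_rank_of_isDomain (Submodule.span A (Set.range v))
    rw [hspan, ← finrank_eq_rank, ← finrank_eq_rank] at this
    have : finrank A (N ⧸ Submodule.span A (Set.range v)) + finrank A N = finrank A N := by
      exact_mod_cast this
    lia
  have htors : Module.IsTorsion A (N ⧸ Submodule.span A (Set.range v)) :=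
    Module.finrank_eq_zero_iff_isTorsion.mp h0
  obtain ⟨s, hs, hs0⟩ := Submodule.annihilator_top_inter_nonZeroDivisors htors
  refine ⟨s, nonZeroDivisors.ne_zero hs0, fun x ↦ ?_⟩
  rw [← Submodule.Quotient.mk_eq_zero, Submodule.Quotient.mk_smul]
  exact Submodule.mem_annihilator.mp hs _ trivial

/-- The span is a quotient of a submodule of the image of `(B ⧸ J)^n`, in fact contained in that
image. -/
lemma length_span_range_le {B : Type u} [CommRing B] (J : Ideal B) {N : Type v} [AddCommGroup N]
    [Module B N] (hJ : ∀ r ∈ J, ∀ x : N, r • x = 0) {n : ℕ} (v : Fin n → N) :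
    Module.length B (Submodule.span B (Set.range v)) ≤ n * Module.length B (B ⧸ J) := by
  let f : (Fin n → B ⧸ J) →ₗ[B] N := LinearMap.lsum B (fun _ ↦ B ⧸ J) B fun i ↦
    Submodule.liftQ J (LinearMap.toSpanSingleton B N (v i))
      (show J ≤ LinearMap.ker _ from fun r hr ↦ LinearMap.mem_ker.mpr (hJ r hr _))
  have hf : Submodule.span B (Set.range v) ≤ LinearMap.range f := by
    rw [Submodule.span_le]
    rintro _ ⟨i, rfl⟩
    refine ⟨Pi.single i 1, ?_⟩
    rw [LinearMap.lsum_piSingle]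
    exact one_smul B (v i)
  calc Module.length B (Submodule.span B (Set.range v))
      ≤ Module.length B (LinearMap.range f) :=
        Module.length_le_of_injective (Submodule.inclusion hf) (Submodule.inclusion_injective hf)
    _ ≤ Module.length B (Fin n → B ⧸ J) :=
        Module.length_le_of_surjective f.rangeRestrict f.surjective_rangeRestrict
    _ = _ := by rw [Module.length_pi_of_fintype]; simp

lemma isFiniteLength_of_pow_smul_eq_zero {B : Type u} [CommRing B] [IsLocalRing B]
    [IsNoetherianRing B] {N : Type v} [AddCommGroup N] [Module B N] [Module.Finite B N] {k : ℕ}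
    (h : ∀ r ∈ maximalIdeal B ^ k, ∀ x : N, r • x = 0) : IsFiniteLength B N := by
  rw [← Module.length_ne_top_iff]
  obtain ⟨n, v, hv⟩ := Module.Finite.exists_fin (R := B) (M := N)
  have h1 := length_span_range_le _ h v
  rw [hv, Module.length_top] at h1
  refine ne_top_of_le_ne_top ?_ h1
  exact WithTop.mul_ne_top (ENat.natCast_ne_top n)
    (Module.length_ne_top_iff.mpr (isFiniteLength_quotient_of_pow_le le_rfl))

/-- By Nakayama's lemma the nonzero powers of the maximal ideal decrease strictly, so each step adds
at least one to the length. -/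
lemma le_length_quotient_pow {B : Type u} [CommRing B] [IsLocalRing B] [IsNoetherianRing B]
    (h : ∀ n, maximalIdeal B ^ n ≠ ⊥) (n : ℕ) :
    (n : ℕ∞) ≤ Module.length B (B ⧸ maximalIdeal B ^ n) := by
  induction n with
  | zero => simp
  | succ n ih =>
    have hle : maximalIdeal B ^ (n + 1) ≤ maximalIdeal B ^ n := Ideal.pow_le_pow_right n.le_succ
    let f := Submodule.factor hle
    rw [Module.length_eq_add_of_exact (LinearMap.ker f).subtype f (Submodule.injective_subtype _)
      (Submodule.factor_surjective hle) (LinearMap.exact_subtype_ker_map f),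
      add_comm (Module.length B (LinearMap.ker f)), Nat.cast_add, Nat.cast_one]
    refine add_le_add ih ?_
    rw [Order.one_le_iff_pos, Module.length_pos_iff, Submodule.nontrivial_iff_ne_bot]
    intro hker
    apply h n
    have hle' : maximalIdeal B ^ n ≤ maximalIdeal B ^ (n + 1) := by
      intro x hx
      have : (Submodule.mkQ (maximalIdeal B ^ (n + 1)) x) ∈ LinearMap.ker f := by
        rw [LinearMap.mem_ker]
        exact (Submodule.Quotient.mk_eq_zero _).mpr hx
      rw [hker, Submodule.mem_bot] at this
      exact (Submodule.Quotient.mk_eq_zero _).mp this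
    apply Submodule.eq_bot_of_le_smul_of_le_jacobson_bot (maximalIdeal B) _
      (IsNoetherian.noetherian _) _ (maximalIdeal_le_jacobson _)
    rwa [smul_eq_mul, ← pow_succ']

end

/-! ### Strict drop of the Frobenius rank along inclusions of primes -/

section

open IsLocalRing Module

open FrobeniusPushforward

lemma exists_add_mul_lt_two_pow (a c : ℕ) : ∃ e, a + c * e < 2 ^ e := by
  refine ⟨2 * (a + 2 * c), ?_⟩
  have h : a + 2 * c < 2 ^ (a + 2 * c) := Nat.lt_two_pow_self
  rw [two_mul, pow_add]
  nlinarith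

lemma isFiniteLength_pushforward_residueField (p : ℕ) (B : Type u) [CommRing B] [IsLocalRing B]
    [IsNoetherianRing B] [ExpChar B p] [IsFFinite p B] :
    IsFiniteLength B (FrobeniusPushforward p 1 (ResidueField B)) := by
  have := IsFFinite.finite_pushforward p (R := B) (ResidueField B) 1
  have hp : 0 < p := expChar_pos B p
  refine isFiniteLength_of_pow_smul_eq_zero (k := 1) fun r hr x ↦ ?_
  rw [pow_one] at hr
  apply (of p 1 (ResidueField B)).symm.injective
  rw [of_symm_smul, Algebra.smul_def, ResidueField.algebraMap_eq, map_pow,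
    (residue_eq_zero_iff r).mpr hr, zero_pow (by positivity), zero_mul, map_zero]

/-- In a one-dimensional `F`-finite local domain, Frobenius has larger rank generically than at the
closed point. -/
lemma residueLength_lt_frobeniusRank (p : ℕ) [hp : Fact p.Prime] (B : Type u) [CommRing B]
    [IsLocalRing B] [IsDomain B] [IsNoetherianRing B] [ExpChar B p] [IsFFinite p B]
    (h0 : maximalIdeal B ≠ ⊥) (h1 : ∀ P : Ideal B, P.IsPrime → P ≠ ⊥ → P = maximalIdeal B) :
    residueLength p B < frobeniusRank p B := by
  have hfin := IsFFinite.finite (p := p) (R := B)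
  obtain ⟨v, -, s, hs0, hs⟩ := exists_linearIndependent_smul_mem_span B
    (FrobeniusPushforward p 1 B)
  change Fin (frobeniusRank p B) → _ at v
  let T := FrobeniusPushforward p 1 B ⧸ Submodule.span B (Set.range v)
  have hT : IsFiniteLength B T := by
    -- Any prime containing `s ≠ 0` is maximal, so the torsion quotient `T`, killed by `s`, has
    -- finite length.
    obtain ⟨k, hk⟩ : ∃ k, maximalIdeal B ^ k ≤ Ideal.span {s} := by
      apply Ideal.exists_pow_le_of_le_radical_of_fg _ (IsNoetherian.noetherian _)
      rw [Ideal.radical_eq_sInf]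
      refine le_sInf fun P hP ↦ ?_
      rw [h1 P hP.2]
      rintro rfl
      exact hs0 (by simpa using hP.1)
    refine isFiniteLength_of_pow_smul_eq_zero (k := k) fun r hr x ↦ ?_
    obtain ⟨x, rfl⟩ := Submodule.Quotient.mk_surjective _ x
    obtain ⟨c, rfl⟩ := Ideal.mem_span_singleton'.mp (hk hr)
    have : (Submodule.Quotient.mk (s • x) : T) = 0 := (Submodule.Quotient.mk_eq_zero _).mpr (hs x)
    rw [Submodule.Quotient.mk_smul] at this
    rw [mul_smul]
    exact (congrArg (c • ·) this).trans (smul_zero c)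
  have hfb (e : ℕ) : IsFiniteLength B (B ⧸ (maximalIdeal B).frobeniusPower p e) := by
    obtain ⟨k, hk⟩ := (maximalIdeal B).exists_pow_le_frobeniusPower p e
      (m := maximalIdeal B) Ideal.le_radical
    exact isFiniteLength_quotient_of_pow_le hk
  -- The left side is the length of `F_*(B / m^[p^(e+1)])`. This module is killed by `m^[p^e]`; the
  -- images of `v` span a submodule bounded by copies of `B / m^[p^e]`, and the remaining quotient
  -- is a quotient of `T`.
  have step (e : ℕ) : residueLength p B *
      Module.length B (B ⧸ (maximalIdeal B).frobeniusPower p (e + 1)) ≤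
      frobeniusRank p B * Module.length B (B ⧸ (maximalIdeal B).frobeniusPower p e) +
        Module.length B T := by
    rw [← length_eq_residueLength_mul p B (hfb (e + 1))]
    let J := (maximalIdeal B).frobeniusPower p (e + 1)
    let π : FrobeniusPushforward p 1 B →ₗ[B] FrobeniusPushforward p 1 (B ⧸ J) :=
      FrobeniusPushforward.map p 1 (Submodule.mkQ J)
    have hπ : Function.Surjective π := map_surjective p 1 (Submodule.mkQ_surjective J)
    let P := Submodule.span B (Set.range (π ∘ v))
    rw [Module.length_eq_add_of_exact P.subtype P.mkQ P.injective_subtype P.mkQ_surjective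
      (LinearMap.exact_subtype_mkQ P)]
    refine add_le_add (length_span_range_le _ (fun r hr x ↦ ?_) _) ?_
    · obtain ⟨x, rfl⟩ := hπ x
      rw [← map_smul]
      change Submodule.mkQ J (r ^ p ^ 1 * (of p 1 B).symm x) = 0
      rw [Submodule.mkQ_apply, Submodule.Quotient.mk_eq_zero]
      refine Ideal.mul_mem_right _ _ ?_
      have := Ideal.pow_mem_frobeniusPower _ p 1 hr
      rwa [Ideal.frobeniusPower_frobeniusPower, add_comm] at this
    · have hle : Submodule.span B (Set.range v) ≤ P.comap π := by
        rw [Submodule.span_le]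
        rintro _ ⟨i, rfl⟩
        exact Submodule.subset_span ⟨i, rfl⟩
      refine Module.length_le_of_surjective (Submodule.mapQ _ P π hle) ?_
      intro y
      obtain ⟨y, rfl⟩ := Submodule.Quotient.mk_surjective _ y
      obtain ⟨x, rfl⟩ := hπ y
      exact ⟨Submodule.Quotient.mk x, rfl⟩
  have hnil (n : ℕ) : maximalIdeal B ^ n ≠ ⊥ := pow_ne_zero n h0
  have hlow (e : ℕ) : ((p ^ e : ℕ) : ℕ∞) ≤
      Module.length B (B ⧸ (maximalIdeal B).frobeniusPower p e) :=
    (le_length_quotient_pow hnil _).trans (Module.length_le_of_surjective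
      (Submodule.factor ((maximalIdeal B).frobeniusPower_le_pow p e))
      (Submodule.factor_surjective _))
  have hρ := isFiniteLength_pushforward_residueField p B
  rw [← Module.length_ne_top_iff] at hρ hT
  have hρ1 : 0 < residueLength p B := by
    rw [residueLength, Module.length_pos_iff]
    exact inferInstanceAs (Nontrivial (ResidueField B))
  change residueLength p B ≠ ⊤ at hρ
  simp_rw [← Module.length_ne_top_iff] at hfb
  -- If the generic rank were at most `ρ`, the inequality `step` would make `ρ b(e)` grow at most
  -- linearly in `e`, against `b(e) ≥ p^e`.
  by_contra! hcon
  lift residueLength p B to ℕ using hρ with ρ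
  lift Module.length B T to ℕ using hT with c
  let b (e : ℕ) : ℕ := (Module.length B (B ⧸ (maximalIdeal B).frobeniusPower p e)).toNat
  have hb (e : ℕ) : Module.length B (B ⧸ (maximalIdeal B).frobeniusPower p e) = b e :=
    (ENat.natCast_toNat (hfb e)).symm
  simp_rw [hb] at step hlow
  norm_cast at step hlow hcon hρ1
  have hgrow (e : ℕ) : ρ * b e ≤ ρ * b 0 + c * e := by
    induction e with
    | zero => simp
    | succ e ih =>
      have := step e
      have : frobeniusRank p B * b e ≤ ρ * b e := Nat.mul_le_mul_right _ hcon
      lia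
  obtain ⟨e, he⟩ := exists_add_mul_lt_two_pow (ρ * b 0) c
  have h2 : 2 ^ e ≤ p ^ e := Nat.pow_le_pow_left hp.out.two_le e
  have h3 : b e ≤ ρ * b e := Nat.le_mul_of_pos_left _ hρ1
  have := hgrow e
  have := hlow e
  lia

lemma residueLength_eq_frobeniusRank (p : ℕ) (B : Type u) [CommRing B] [IsLocalRing B]
    [ExpChar B p] [ExpChar (ResidueField B) p] [Module.Finite (ResidueField B)
      (FrobeniusPushforward p 1 (ResidueField B))] :
    residueLength p B = frobeniusRank p (ResidueField B) := by
  have : IsScalarTower B (ResidueField B) (FrobeniusPushforward p 1 (ResidueField B)) :=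
    ⟨fun a b x ↦ by
      apply (of p 1 _).symm.injective
      change (a • b) ^ p ^ 1 * (of p 1 _).symm x = a ^ p ^ 1 • (b ^ p ^ 1 * (of p 1 _).symm x)
      rw [Algebra.smul_def, Algebra.smul_def, mul_pow, map_pow, mul_assoc]⟩
  rw [residueLength, Module.length_eq_of_surjective (R := ResidueField B) residue_surjective,
    Module.length_eq_finrank, frobeniusRank]

/-- The localization of `S / P` at `Q` is a one-dimensional local domain, since no prime lies
strictly between. Its generic rank is that of `S / P`, and its closed point has residue field the
fraction field of `S / Q`. -/
lemma frobeniusRank_quotient_lt_of_covBy (p : ℕ) [hp : Fact p.Prime] (S : Type u) [CommRing S]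
    [IsNoetherianRing S] [CharP S p] [ExpChar S p] [IsFFinite p S] {P Q : PrimeSpectrum S}
    (h : P ⋖ Q) [ExpChar (S ⧸ P.asIdeal) p] [ExpChar (S ⧸ Q.asIdeal) p] :
    frobeniusRank p (S ⧸ Q.asIdeal) < frobeniusRank p (S ⧸ P.asIdeal) := by
  have hker : RingHom.ker (Ideal.Quotient.mk P.asIdeal) ≤ Q.asIdeal := by
    rw [Ideal.mk_ker]; exact h.le
  let A := S ⧸ P.asIdeal
  let Q' : Ideal A := Q.asIdeal.map (Ideal.Quotient.mk P.asIdeal)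
  have hQ' : Q'.IsPrime := Ideal.map_isPrime_of_surjective Ideal.Quotient.mk_surjective hker
  have hcomapQ : Q'.comap (Ideal.Quotient.mk P.asIdeal) = Q.asIdeal := by
    rw [Ideal.comap_map_of_surjective' _ Ideal.Quotient.mk_surjective, Ideal.mk_ker,
      sup_eq_left]
    exact h.le
  let B := Localization.AtPrime Q'
  have hM : Q'.primeCompl ≤ nonZeroDivisors A := Q'.primeCompl_le_nonZeroDivisors
  have : ExpChar B p := expChar_of_injective_algebraMap (IsLocalization.injective B hM) p
  have : IsDomain B := IsLocalization.isDomain_localization hM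
  have := IsFFinite.of_surjective p (R := S) (R' := A) (Ideal.Quotient.mk P.asIdeal)
    Ideal.Quotient.mk_surjective
  have := IsFFinite.of_isLocalization p Q'.primeCompl B
  have : IsNoetherianRing B := IsLocalization.isNoetherianRing Q'.primeCompl B inferInstance
  have : CharP (ResidueField B) p := by
    refine (CharP.charP_iff_prime_eq_zero hp.out).mpr ?_
    rw [← map_natCast (algebraMap S (ResidueField B)), CharP.cast_eq_zero, map_zero]
  have : ExpChar (ResidueField B) p := .prime hp.out
  have hκ := IsFFinite.of_surjective p (residue B) residue_surjective
  have := hκ.finite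
  have hcomap : (maximalIdeal B).comap (algebraMap A B) = Q' :=
    Localization.AtPrime.under_maximalIdeal
  have hlt := residueLength_lt_frobeniusRank p B ?_ ?_
  · rw [residueLength_eq_frobeniusRank, Nat.cast_lt,
      frobeniusRank_eq_of_isLocalization p A Q'.primeCompl hM B] at hlt
    let e : A ⧸ Q' ≃+* S ⧸ Q.asIdeal := DoubleQuot.quotQuotEquivQuotOfLE h.le
    have : ExpChar (A ⧸ Q') p :=
      expChar_of_injective_ringHom (f := e.symm.toRingHom) e.symm.injective p
    rw [← frobeniusRank_eq_of_ringEquiv p e]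
    have := frobeniusRank_eq_of_isLocalization p (A ⧸ Q') (nonZeroDivisors (A ⧸ Q')) le_rfl
      Q'.ResidueField
    rw [← this]
    exact hlt
  · intro h0
    rw [h0, ← RingHom.ker_eq_comap_bot, (RingHom.injective_iff_ker_eq_bot _).mp
      (IsLocalization.injective B hM)] at hcomap
    have := h.lt
    rw [← hcomap, ← RingHom.ker_eq_comap_bot, Ideal.mk_ker] at hcomapQ
    exact this.ne (PrimeSpectrum.ext hcomapQ)
  · intro I hI hI0
    let I' : PrimeSpectrum S := ⟨(I.comap (algebraMap A B)).comap (Ideal.Quotient.mk P.asIdeal),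
      inferInstance⟩
    have hPI : P ≤ I' := by
      intro x hx
      change algebraMap A B (Ideal.Quotient.mk P.asIdeal x) ∈ I
      rw [Ideal.Quotient.eq_zero_iff_mem.mpr hx, map_zero]
      exact I.zero_mem
    have hIQ : I' ≤ Q := by
      change I'.asIdeal ≤ Q.asIdeal
      rw [← hcomapQ, ← hcomap]
      exact Ideal.comap_mono (Ideal.comap_mono (IsLocalRing.le_maximalIdeal hI.ne_top))
    have hne : P ≠ I' := by
      intro heq
      apply hI0
      have h3 : I.comap (algebraMap A B) = ⊥ := by
        rw [← Ideal.map_comap_of_surjective _ Ideal.Quotient.mk_surjective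
          (I.comap (algebraMap A B)),
          show (I.comap (algebraMap A B)).comap (Ideal.Quotient.mk P.asIdeal) = P.asIdeal from
            congrArg PrimeSpectrum.asIdeal heq.symm, Ideal.map_quotient_self]
      rw [← IsLocalization.map_under Q'.primeCompl B I]
      change (I.comap (algebraMap A B)).map _ = _
      rw [h3, Ideal.map_bot]
    have heq : I' = Q := (h.eq_or_eq hPI hIQ).resolve_left hne.symm
    have h4 : I.comap (algebraMap A B) = Q' := by
      rw [← Ideal.map_comap_of_surjective _ Ideal.Quotient.mk_surjective
          (I.comap (algebraMap A B)),
          show (I.comap (algebraMap A B)).comap (Ideal.Quotient.mk P.asIdeal) = Q.asIdeal from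
            congrArg PrimeSpectrum.asIdeal heq]
    rw [← IsLocalization.map_under Q'.primeCompl B I,
      ← IsLocalization.map_under Q'.primeCompl B (maximalIdeal B)]
    congr 1
    exact h4.trans hcomap.symm

end

/-! ### Additive invariants of Frobenius pushforwards -/

section

open IsLocalRing Module

open FrobeniusPushforward

/-- A numerical invariant of modules is additive if it is additive on short exact sequences of
finite modules. -/
def IsAdditiveOnFinite (S : Type u) [CommRing S]
    (χ : ∀ (N : Type u) [AddCommGroup N] [Module S N], ℚ) : Prop :=
  ∀ (N₁ N₂ N₃ : Type u) [AddCommGroup N₁] [Module S N₁] [AddCommGroup N₂] [Module S N₂]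
    [AddCommGroup N₃] [Module S N₃] [Module.Finite S N₁] [Module.Finite S N₂] [Module.Finite S N₃]
    (f : N₁ →ₗ[S] N₂) (g : N₂ →ₗ[S] N₃), Function.Injective f → Function.Surjective g →
    Function.Exact f g → χ N₂ = χ N₁ + χ N₃

namespace IsAdditiveOnFinite

variable {S : Type u} [CommRing S] {χ : ∀ (N : Type u) [AddCommGroup N] [Module S N], ℚ}

lemma eq_zero (hχ : IsAdditiveOnFinite S χ) (N : Type u) [AddCommGroup N] [Module S N]
    [Subsingleton N] : χ N = 0 := by
  have : Module.Finite S N := inferInstance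
  have := hχ N N N LinearMap.id LinearMap.id Function.injective_id Function.surjective_id
    (fun x ↦ by simp [Subsingleton.elim x 0])
  linarith

lemma eq_of_equiv (hχ : IsAdditiveOnFinite S χ) {N N' : Type u} [AddCommGroup N] [Module S N]
    [AddCommGroup N'] [Module S N']
    [Module.Finite S N] (e : N ≃ₗ[S] N') : χ N = χ N' := by
  have : Module.Finite S N' := Module.Finite.equiv e
  have := hχ N N' PUnit e.toLinearMap 0 e.injective (Function.surjective_to_subsingleton _)
    ((e.toLinearMap.exact_zero_iff_surjective _).2 e.surjective)
  rw [this, hχ.eq_zero PUnit, add_zero]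

lemma pi_fin (hχ : IsAdditiveOnFinite S χ) (N : Type u) [AddCommGroup N] [Module S N]
    [Module.Finite S N] (n : ℕ) :
    χ (Fin n → N) = n * χ N := by
  induction n with
  | zero => rw [hχ.eq_zero]; simp
  | succ n ih =>
    rw [hχ N (Fin (n + 1) → N) (Fin n → N) (LinearMap.single S (fun _ ↦ N) 0)
      (LinearMap.funLeft S N Fin.succ) (Pi.single_injective (M := fun _ : Fin (n + 1) ↦ N) 0)
      (LinearMap.funLeft_surjective_of_injective _ _ _ (Fin.succ_injective n)) ?_, ih]
    · push_cast; ring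
    · intro x
      constructor
      · intro h
        refine ⟨x 0, ?_⟩
        ext i
        refine Fin.cases (by simp) (fun j ↦ ?_) i
        have := congrFun h j
        simpa [LinearMap.funLeft_apply] using this.symm
      · rintro ⟨y, rfl⟩
        ext j
        simp [LinearMap.funLeft_apply]

end IsAdditiveOnFinite

lemma PrimeSpectrum.wellFoundedGT (S : Type u) [CommRing S] [IsLocalRing S]
    [IsNoetherianRing S] : WellFoundedGT (PrimeSpectrum S) := by
  have : FiniteDimensionalOrder (PrimeSpectrum S) := inferInstanceAs (FiniteRingKrullDim S)
  exact ⟨SetRel.IsWellFounded.inv_of_finiteDimensional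
    (r := {(a, b) : PrimeSpectrum S × _ | a < b})⟩

lemma PrimeSpectrum.exists_covBy_le_of_lt {S : Type u} [CommRing S] [IsLocalRing S]
    [IsNoetherianRing S] {P Q : PrimeSpectrum S} (h : P < Q) : ∃ P', P ⋖ P' ∧ P' ≤ Q := by
  have : FiniteDimensionalOrder (PrimeSpectrum S) := inferInstanceAs (FiniteRingKrullDim S)
  have : WellFoundedLT (PrimeSpectrum S) :=
    ⟨SetRel.IsWellFounded.of_finiteDimensional (r := {(a, b) : PrimeSpectrum S × _ | a < b})⟩
  exact _root_.exists_covBy_le_of_lt h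

section Geometric

/-- The span of the geometric progressions with ratios in `Λ`. -/
def geometricSpan (Λ : Set ℚ) : Submodule ℚ (ℕ → ℚ) :=
  Submodule.span ℚ ((fun (l : ℚ) (e : ℕ) ↦ l ^ e) '' Λ)

lemma geometricSpan_mono {Λ Λ' : Set ℚ} (h : Λ ⊆ Λ') : geometricSpan Λ ≤ geometricSpan Λ' :=
  Submodule.span_mono (Set.image_mono h)

/-- For `h e = l ^ e` a particular solution is `(l - r)⁻¹ l ^ e`, available because `l ≠ r`;
resonance would produce a term `e r ^ e`. Two solutions differ by a multiple of `r ^ e`. -/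
lemma mem_geometricSpan_of_recurrence {Λ : Set ℚ} {r : ℚ} (hr : r ∉ Λ) {f h : ℕ → ℚ}
    (hh : h ∈ geometricSpan Λ) (hf : ∀ e, f (e + 1) = r * f e + h e) :
    f ∈ geometricSpan (insert r Λ) := by
  have hex : ∃ g ∈ geometricSpan Λ, ∀ e, g (e + 1) = r * g e + h e := by
    clear hf
    induction hh using Submodule.span_induction with
    | mem x hx =>
      obtain ⟨l, hl, rfl⟩ := hx
      have hne : l - r ≠ 0 := sub_ne_zero.mpr (by rintro rfl; exact hr hl)
      refine ⟨(l - r)⁻¹ • fun e ↦ l ^ e,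
        Submodule.smul_mem _ _ (Submodule.subset_span ⟨l, hl, rfl⟩), fun e ↦ ?_⟩
      simp only [Pi.smul_apply, smul_eq_mul]
      field_simp
      ring
    | zero => exact ⟨0, Submodule.zero_mem _, by simp⟩
    | add x y _ _ hx hy =>
      obtain ⟨g, hg, hg'⟩ := hx
      obtain ⟨k, hk, hk'⟩ := hy
      exact ⟨g + k, add_mem hg hk, fun e ↦ by simp only [Pi.add_apply, hg', hk']; ring⟩
    | smul a x _ hx =>
      obtain ⟨g, hg, hg'⟩ := hx
      exact ⟨a • g, Submodule.smul_mem _ _ hg, fun e ↦ by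
        simp only [Pi.smul_apply, smul_eq_mul, hg']; ring⟩
  obtain ⟨g, hg, hg'⟩ := hex
  have hfg : f = g + (f 0 - g 0) • fun e ↦ r ^ e := by
    ext e
    induction e with
    | zero => simp
    | succ e ih =>
      rw [hf, ih]
      simp only [Pi.add_apply, Pi.smul_apply, smul_eq_mul, hg']
      ring
  rw [hfg]
  exact add_mem (geometricSpan_mono (Set.subset_insert r Λ) hg) (Submodule.smul_mem _ _
    (Submodule.subset_span ⟨r, Set.mem_insert r Λ, rfl⟩))

lemma exists_polynomial_of_mem_geometricSpan {p : ℕ} {Λ : Set ℚ}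
    (hΛ : ∀ l ∈ Λ, ∃ i : ℕ, l = (p : ℚ) ^ i) {f : ℕ → ℚ} (hf : f ∈ geometricSpan Λ) :
    ∃ F : Polynomial ℚ, ∀ e, f e = F.eval ((p : ℚ) ^ e) := by
  induction hf using Submodule.span_induction with
  | mem x hx =>
    obtain ⟨l, hl, rfl⟩ := hx
    obtain ⟨i, rfl⟩ := hΛ l hl
    exact ⟨Polynomial.X ^ i, fun e ↦ by simp [← pow_mul, mul_comm]⟩
  | zero => exact ⟨0, by simp⟩
  | add x y _ _ hx hy =>
    obtain ⟨F, hF⟩ := hx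
    obtain ⟨G, hG⟩ := hy
    exact ⟨F + G, fun e ↦ by simp [hF, hG]⟩
  | smul a x _ hx =>
    obtain ⟨F, hF⟩ := hx
    exact ⟨Polynomial.C a * F, fun e ↦ by simp [hF]⟩

end Geometric

section FFinite

variable (p : ℕ) [hp : Fact p.Prime] (S : Type u) [CommRing S] [CharP S p] [ExpChar S p]

instance PrimeSpectrum.expChar_quotient (P : PrimeSpectrum S) : ExpChar (S ⧸ P.asIdeal) p := by
  have : CharP (S ⧸ P.asIdeal) p := by
    refine (CharP.charP_iff_prime_eq_zero hp.out).mpr ?_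
    rw [← map_natCast (algebraMap S (S ⧸ P.asIdeal)), CharP.cast_eq_zero, map_zero]
  exact .prime hp.out

/-- The rank of Frobenius on the integral closed subscheme defined by a prime. -/
noncomputable def PrimeSpectrum.frobeniusRank (P : PrimeSpectrum S) : ℕ :=
  _root_.frobeniusRank p (S ⧸ P.asIdeal)

variable [IsNoetherianRing S] [IsFFinite p S]

omit [IsNoetherianRing S] in
lemma PrimeSpectrum.exists_frobeniusRank_eq_pow (P : PrimeSpectrum S) :
    ∃ i, P.frobeniusRank p S = p ^ i := by
  have := IsFFinite.of_surjective p (Ideal.Quotient.mk P.asIdeal) Ideal.Quotient.mk_surjective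
  exact _root_.exists_frobeniusRank_eq_pow p _

lemma PrimeSpectrum.frobeniusRank_lt [IsLocalRing S] {P Q : PrimeSpectrum S} (h : P < Q) :
    Q.frobeniusRank p S < P.frobeniusRank p S := by
  have := PrimeSpectrum.wellFoundedGT S
  induction P using WellFoundedGT.induction with
  | ind P ih =>
    obtain ⟨P', hP', hQ⟩ := PrimeSpectrum.exists_covBy_le_of_lt h
    have h1 : P'.frobeniusRank p S < P.frobeniusRank p S :=
      frobeniusRank_quotient_lt_of_covBy p S hP'
    obtain rfl | hlt := hQ.eq_or_lt
    · exact h1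
    · exact (ih P' hP'.lt hlt).trans h1

omit [IsNoetherianRing S] in
/-- The Frobenius pushforward of `S ⧸ P` contains a free `S ⧸ P`-module with torsion quotient. -/
lemma PrimeSpectrum.exists_injective_pushforward (P : PrimeSpectrum S) :
    ∃ f : (Fin (P.frobeniusRank p S) → S ⧸ P.asIdeal) →ₗ[S]
      FrobeniusPushforward p 1 (S ⧸ P.asIdeal), Function.Injective f ∧
      ∀ Q ∈ Module.support S (FrobeniusPushforward p 1 (S ⧸ P.asIdeal) ⧸ LinearMap.range f),
        P < Q := by
  let A := S ⧸ P.asIdeal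
  have := IsFFinite.of_surjective p (Ideal.Quotient.mk P.asIdeal) Ideal.Quotient.mk_surjective
  have := IsFFinite.finite (p := p) (R := A)
  have : IsScalarTower S A (FrobeniusPushforward p 1 A) := ⟨fun a b x ↦ by
    apply (of p 1 _).symm.injective
    change (a • b) ^ p ^ 1 * (of p 1 _).symm x = a ^ p ^ 1 • (b ^ p ^ 1 * (of p 1 _).symm x)
    rw [Algebra.smul_def, Algebra.smul_def, mul_pow, map_pow, mul_assoc]⟩
  obtain ⟨v, hv, s, hs0, hs⟩ := exists_linearIndependent_smul_mem_span A
    (FrobeniusPushforward p 1 A)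
  let g := Fintype.linearCombination A v
  have hgr : LinearMap.range g = Submodule.span A (Set.range v) :=
    Fintype.range_linearCombination A v
  refine ⟨g.restrictScalars S, hv.fintypeLinearCombination_injective, fun Q hQ ↦ ?_⟩
  -- The cokernel is killed by `P` and by an `s` outside `P`, so its support lies strictly above
  -- `P`.
  obtain ⟨s, rfl⟩ := Ideal.Quotient.mk_surjective s
  have hann := Module.annihilator_le_of_mem_support hQ
  have hsQ : s ∈ Q.asIdeal := by
    apply hann
    rw [Module.mem_annihilator]
    intro x
    obtain ⟨x, rfl⟩ := Submodule.Quotient.mk_surjective _ x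
    rw [← Submodule.Quotient.mk_smul, Submodule.Quotient.mk_eq_zero]
    change s • x ∈ LinearMap.range g
    rw [hgr]
    exact hs x
  have hPQ : P ≤ Q := by
    intro a ha
    apply hann
    rw [Module.mem_annihilator]
    intro x
    obtain ⟨x, rfl⟩ := Submodule.Quotient.mk_surjective _ x
    have : a • x = 0 := by
      rw [← algebraMap_smul A a x, Ideal.Quotient.algebraMap_eq,
        Ideal.Quotient.eq_zero_iff_mem.mpr ha, zero_smul]
    rw [← Submodule.Quotient.mk_smul, this, Submodule.Quotient.mk_zero]
  refine hPQ.lt_of_ne ?_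
  rintro rfl
  exact hs0 (Ideal.Quotient.eq_zero_iff_mem.mpr hsQ)

variable {S} {χ : ∀ (N : Type u) [AddCommGroup N] [Module S N], ℚ}

-- Dévissage along a prime filtration: every prime that occurs lies in the support of `N`, and the
-- pushforward keeps the sequences exact.
omit hp [CharP S p] in
lemma IsAdditiveOnFinite.pushforward_mem_geometricSpan_of_support (hχ : IsAdditiveOnFinite S χ)
    (Λ : Set (PrimeSpectrum S)) (W : Submodule ℚ (ℕ → ℚ))
    (hW : ∀ Q ∈ Λ, (fun e ↦ χ (FrobeniusPushforward p e (S ⧸ Q.asIdeal))) ∈ W)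
    (N : Type u) [AddCommGroup N] [Module S N] [hN : Module.Finite S N]
    (hsupp : Module.support S N ⊆ Λ) :
    (fun e ↦ χ (FrobeniusPushforward p e N)) ∈ W := by
  induction hN using IsNoetherianRing.induction_on_isQuotientEquivQuotientPrime S with
  | subsingleton N =>
    convert W.zero_mem with e
    exact hχ.eq_zero _
  | quotient N Q f =>
    convert hW Q (hsupp ?_) using 1
    · ext e
      have := IsFFinite.finite_pushforward p (R := S) N e
      exact hχ.eq_of_equiv (FrobeniusPushforward.congr p e f)
    · rw [f.support_eq, Module.mem_support_iff_of_finite, Ideal.annihilator_quotient]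
  | exact N₁ N₂ N₃ f g hf hg hfg h₁ h₃ =>
    rw [Module.support_of_exact hfg hf hg] at hsupp
    convert W.add_mem (h₁ (Set.subset_union_left.trans hsupp))
      (h₃ (Set.subset_union_right.trans hsupp)) using 1
    ext e
    have := IsFFinite.finite_pushforward p (R := S) N₁ e
    have := IsFFinite.finite_pushforward p (R := S) N₂ e
    have := IsFFinite.finite_pushforward p (R := S) N₃ e
    exact hχ _ _ _ (FrobeniusPushforward.map p e f) (FrobeniusPushforward.map p e g)
      (map_injective p e hf) (map_surjective p e hg) (map_exact p e hfg)

/-- The ranks of Frobenius at the primes of a set. -/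
def frobeniusRanks (Λ : Set (PrimeSpectrum S)) : Set ℚ :=
  (fun Q : PrimeSpectrum S ↦ (Q.frobeniusRank p S : ℚ)) '' Λ

/-- Induction from the larger primes downwards. Pushing forward `0 → (S/P)^r → F_*(S/P) → T → 0` by
`F^e_*` gives a recurrence of ratio `r`, whose inhomogeneous term involves only ranks at primes
above `P`, all smaller than `r`. -/
lemma IsAdditiveOnFinite.pushforward_quotient_mem_geometricSpan [IsLocalRing S]
    (hχ : IsAdditiveOnFinite S χ) (P : PrimeSpectrum S) :
    (fun e ↦ χ (FrobeniusPushforward p e (S ⧸ P.asIdeal))) ∈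
      geometricSpan (frobeniusRanks p (Set.Ici P)) := by
  have := PrimeSpectrum.wellFoundedGT S
  induction P using WellFoundedGT.induction with
  | ind P ih =>
    obtain ⟨f, hf, hsupp⟩ := P.exists_injective_pushforward p S
    have := IsFFinite.finite_pushforward p (R := S) (S ⧸ P.asIdeal) 1
    have hT := hχ.pushforward_mem_geometricSpan_of_support p (Set.Ioi P)
      (geometricSpan (frobeniusRanks p (Set.Ioi P)))
      (fun Q hQ ↦ geometricSpan_mono (Set.image_mono (Set.Ici_subset_Ioi.mpr hQ)) (ih Q hQ))
      (FrobeniusPushforward p 1 (S ⧸ P.asIdeal) ⧸ LinearMap.range f) hsupp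
    have hset : frobeniusRanks p (Set.Ici P) =
        insert (P.frobeniusRank p S : ℚ) (frobeniusRanks p (Set.Ioi P)) := by
      rw [frobeniusRanks, ← Set.Ioi_insert, Set.image_insert_eq, frobeniusRanks]
    rw [hset]
    refine mem_geometricSpan_of_recurrence ?_ hT fun e ↦ ?_
    · rintro ⟨Q, hQ, h⟩
      exact (PrimeSpectrum.frobeniusRank_lt p S hQ).ne (Nat.cast_injective h)
    · have hfin (N : Type u) [AddCommGroup N] [Module S N] [Module.Finite S N] :=
        IsFFinite.finite_pushforward p (R := S) N e
      have := IsFFinite.finite_pushforward p (R := S) (S ⧸ P.asIdeal) (e + 1)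
      rw [← hχ.eq_of_equiv (comp p e S (S ⧸ P.asIdeal) 1).symm.symm,
        hχ _ _ _ (FrobeniusPushforward.map p e f)
          (FrobeniusPushforward.map p e (LinearMap.range f).mkQ) (map_injective p e hf)
          (map_surjective p e (Submodule.mkQ_surjective _))
          (map_exact p e (LinearMap.exact_map_mkQ_range f)), ← hχ.pi_fin]
      -- The pushforward of a finite power is definitionally the finite power of the pushforward.
      congr 1

/-- An additive invariant of the Frobenius pushforwards of a finite module over an `F`-finite
Noetherian local ring is a polynomial in `p ^ e`. -/
theorem IsAdditiveOnFinite.exists_polynomial_pushforward [IsLocalRing S]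
    (hχ : IsAdditiveOnFinite S χ) (N : Type u) [AddCommGroup N] [Module S N] [Module.Finite S N] :
    ∃ F : Polynomial ℚ, ∀ e, χ (FrobeniusPushforward p e N) = F.eval ((p : ℚ) ^ e) := by
  refine exists_polynomial_of_mem_geometricSpan (Λ := frobeniusRanks (S := S) p Set.univ) ?_
    (hχ.pushforward_mem_geometricSpan_of_support p Set.univ _ (fun Q _ ↦ ?_) N
      (Set.subset_univ _))
  · rintro _ ⟨Q, -, rfl⟩
    obtain ⟨i, hi⟩ := Q.exists_frobeniusRank_eq_pow p S
    exact ⟨i, by simp [hi]⟩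
  · exact geometricSpan_mono (Set.image_mono (Set.subset_univ _))
      (hχ.pushforward_quotient_mem_geometricSpan p Q)

end FFinite

end

/-! ### Homology of a complex tensored with a module -/

section

open CategoryTheory MonoidalCategory

namespace ChainComplex

variable {S : Type u} [CommRing S] (C : ChainComplex (ModuleCat.{u} S) ℕ)

/-- The tensor product of a complex of modules with a module. -/
noncomputable def tensorModule (N : Type u) [AddCommGroup N] [Module S N] :
    ChainComplex (ModuleCat.{u} S) ℕ :=
  ((tensorRight (ModuleCat.of S N)).mapHomologicalComplex _).obj C

/-- The homology of the tensor product of a complex of modules with a module. -/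
noncomputable abbrev tensorHomology (i : ℕ) (N : Type u) [AddCommGroup N] [Module S N] :
    ModuleCat.{u} S :=
  (C.tensorModule N).homology i

section

variable {N N' N'' : Type u} [AddCommGroup N] [Module S N] [AddCommGroup N'] [Module S N']
  [AddCommGroup N''] [Module S N'']

/-- The map of complexes induced by a linear map. -/
noncomputable def tensorModuleMap (f : N →ₗ[S] N') : C.tensorModule N ⟶ C.tensorModule N' where
  f i := C.X i ◁ ModuleCat.ofHom f
  comm' i j _ := whisker_exchange (C.d i j) (ModuleCat.ofHom f)

/-- The map on the homology of tensor products induced by a linear map. -/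
noncomputable def tensorHomologyMap (i : ℕ) (f : N →ₗ[S] N') :
    C.tensorHomology i N →ₗ[S] C.tensorHomology i N' :=
  (HomologicalComplex.homologyMap (C.tensorModuleMap f) i).hom

lemma tensorHomologyMap_comp (i : ℕ) (f : N →ₗ[S] N') (g : N' →ₗ[S] N'') :
    C.tensorHomologyMap i (g ∘ₗ f) = C.tensorHomologyMap i g ∘ₗ C.tensorHomologyMap i f := by
  have : C.tensorModuleMap (g ∘ₗ f) = C.tensorModuleMap f ≫ C.tensorModuleMap g := by
    ext1 j
    exact whiskerLeft_comp (C.X j) (ModuleCat.ofHom f) (ModuleCat.ofHom g)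
  rw [tensorHomologyMap, this, HomologicalComplex.homologyMap_comp]
  rfl

lemma tensorHomologyMap_smul_id (i : ℕ) (r : S) :
    C.tensorHomologyMap i (r • LinearMap.id : N →ₗ[S] N) = r • LinearMap.id := by
  have h : C.tensorModuleMap (r • LinearMap.id : N →ₗ[S] N) = r • 𝟙 _ := by
    ext1 j
    rw [HomologicalComplex.smul_f_apply, HomologicalComplex.id_f]
    change C.X j ◁ (r • 𝟙 (ModuleCat.of S N)) = r • 𝟙 (C.X j ⊗ ModuleCat.of S N)
    rw [MonoidalLinear.whiskerLeft_smul, whiskerLeft_id]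
  rw [tensorHomologyMap, h]
  change ((ShortComplex.homologyMap (r • 𝟙 ((C.tensorModule N).sc i)))).hom = _
  rw [ShortComplex.homologyMap_smul, ShortComplex.homologyMap_id]
  rfl

lemma tensorHomologyMap_id (i : ℕ) :
    C.tensorHomologyMap i (LinearMap.id : N →ₗ[S] N) = LinearMap.id := by
  simpa using C.tensorHomologyMap_smul_id (N := N) i 1

/-- Flatness of the terms makes the three tensored complexes a short exact sequence; this is its
long exact homology sequence. -/
lemma exists_connecting [∀ i, Module.Flat S (C.X i)] {f : N →ₗ[S] N'} {g : N' →ₗ[S] N''}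
    (hf : Function.Injective f) (hg : Function.Surjective g) (hfg : Function.Exact f g) :
    Function.Surjective (C.tensorHomologyMap 0 g) ∧
    (∀ i, Function.Exact (C.tensorHomologyMap i f) (C.tensorHomologyMap i g)) ∧
    ∃ δ : ∀ i, C.tensorHomology (i + 1) N'' →ₗ[S] C.tensorHomology i N,
      (∀ i, Function.Exact (C.tensorHomologyMap (i + 1) g) (δ i)) ∧
      (∀ i, Function.Exact (δ i) (C.tensorHomologyMap i f)) := by
  have hcomp : C.tensorModuleMap f ≫ C.tensorModuleMap g = 0 := by
    ext1 j
    change C.X j ◁ ModuleCat.ofHom f ≫ C.X j ◁ ModuleCat.ofHom g = 0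
    rw [← whiskerLeft_comp, ← ModuleCat.ofHom_comp, hfg.linearMap_comp_eq_zero]
    exact MonoidalPreadditive.whiskerLeft_zero
  let K : ShortComplex (ChainComplex (ModuleCat.{u} S) ℕ) :=
    ⟨C.tensorModuleMap f, C.tensorModuleMap g, hcomp⟩
  have hK : K.ShortExact := by
    refine HomologicalComplex.shortExact_of_degreewise_shortExact K fun i ↦ ?_
    refine { exact := ?_, mono_f := ?_, epi_g := ?_ }
    · rw [ShortComplex.ShortExact.moduleCat_exact_iff_function_exact]
      exact Module.Flat.lTensor_exact (C.X i) hfg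
    · rw [ModuleCat.mono_iff_injective]
      exact Module.Flat.lTensor_preserves_injective_linearMap (M := C.X i) f hf
    · rw [ModuleCat.epi_iff_surjective]
      exact LinearMap.lTensor_surjective (C.X i) hg
  have hrel : ∀ i, (ComplexShape.down ℕ).Rel (i + 1) i := fun i ↦ rfl
  refine ⟨?_, fun i ↦ ?_, fun i ↦ (hK.δ (i + 1) i (hrel i)).hom, fun i ↦ ?_, fun i ↦ ?_⟩
  · have := hK.epi_g
    have : Epi (HomologicalComplex.homologyMap K.g 0) :=
      HomologicalComplex.epi_homologyMap_of_epi_of_not_rel _ _ (by simp)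
    exact (ModuleCat.epi_iff_surjective _).1 this
  · exact (ShortComplex.ShortExact.moduleCat_exact_iff_function_exact _).1 (hK.homology_exact₂ i)
  · exact (ShortComplex.ShortExact.moduleCat_exact_iff_function_exact _).1
      (hK.homology_exact₃ (i + 1) i (hrel i))
  · exact (ShortComplex.ShortExact.moduleCat_exact_iff_function_exact _).1
      (hK.homology_exact₁ (i + 1) i (hrel i))

end

end ChainComplex

end

/-! ### Finite flat resolutions -/

section

open CategoryTheory MonoidalCategory

namespace ChainComplex

variable {S : Type u} [CommRing S]

/-- A complex of flat modules with an augmentation that is a resolution of the target. -/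
structure IsFlatResolution (C : ChainComplex (ModuleCat.{u} S) ℕ) {M : ModuleCat.{u} S}
    (ε : C.X 0 ⟶ M) : Prop where
  flat (i : ℕ) : Module.Flat S (C.X i)
  surjective : Function.Surjective ε
  exact_zero : Function.Exact (C.d 1 0) ε
  exact_succ (i : ℕ) : Function.Exact (C.d (i + 2) (i + 1)) (C.d (i + 1) i)

/-- Splices a resolution of the kernel `K` with `P`, the inductive step in resolving a module of
finite projective dimension. -/
lemma IsFlatResolution.exists_augment {C : ChainComplex (ModuleCat.{u} S) ℕ}
    {K P M : ModuleCat.{u} S} {ε : C.X 0 ⟶ K} (h : C.IsFlatResolution ε) [Module.Flat S P]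
    (f : K ⟶ P) (g : P ⟶ M) (hf : Function.Injective f) (hg : Function.Surjective g)
    (hfg : Function.Exact f g) (n : ℕ) (hn : ∀ i, n ≤ i → Subsingleton (C.X i)) :
    ∃ (C : ChainComplex (ModuleCat.{u} S) ℕ) (ε : C.X 0 ⟶ M), C.IsFlatResolution ε ∧
      ∀ i, n + 1 ≤ i → Subsingleton (C.X i) := by
  have w : C.d 1 0 ≫ ε ≫ f = 0 := by
    rw [← Category.assoc]
    have : C.d 1 0 ≫ ε = 0 := by
      ext x
      exact h.exact_zero.apply_apply_eq_zero x
    rw [this, Limits.zero_comp]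
  refine ⟨C.augment (ε ≫ f) w, g, ⟨?_, hg, ?_, ?_⟩, ?_⟩
  · rintro (_ | i)
    · exact inferInstanceAs (Module.Flat S P)
    · exact h.flat i
  · change Function.Exact (ε ≫ f) g
    intro x
    rw [hfg x]
    constructor
    · rintro ⟨y, rfl⟩
      obtain ⟨z, rfl⟩ := h.surjective y
      exact ⟨z, rfl⟩
    · rintro ⟨z, rfl⟩
      exact ⟨ε z, rfl⟩
  · rintro (_ | i)
    · change Function.Exact (C.d 1 0) (ε ≫ f)
      intro x
      rw [← h.exact_zero x]
      exact ⟨fun hx ↦ hf (hx.trans (map_zero f.hom).symm), fun hx ↦ by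
        rw [ConcreteCategory.comp_apply, hx]; exact map_zero f.hom⟩
    · exact h.exact_succ i
  · rintro (_ | i) hi
    · omega
    · exact hn i (by omega)

lemma exists_isFlatResolution_of_hasProjectiveDimensionLE (n : ℕ) (M : ModuleCat.{u} S)
    [HasProjectiveDimensionLE M n] :
    ∃ (C : ChainComplex (ModuleCat.{u} S) ℕ) (ε : C.X 0 ⟶ M), C.IsFlatResolution ε ∧
      ∀ i, n + 1 ≤ i → Subsingleton (C.X i) := by
  induction n generalizing M with
  | zero =>
    have hM : Module.Projective S M := by
      have projle : HasProjectiveDimensionLE M 0 := ‹_›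
      simp only [HasProjectiveDimensionLE, zero_add] at projle
      rwa [← projective_iff_hasProjectiveDimensionLT_one, ← IsProjective.iff_projective] at projle
    -- The zero complex resolves zero; augmenting it by the projective `M` puts `M` alone in degree
    -- `0`.
    let Z : ChainComplex (ModuleCat.{u} S) ℕ :=
      { X := fun _ ↦ ModuleCat.of S PUnit, d := fun _ _ ↦ 0 }
    have hZ : Z.IsFlatResolution (𝟙 (Z.X 0)) := by
      refine ⟨fun i ↦ inferInstanceAs (Module.Flat S PUnit.{u + 1}), fun x ↦ ⟨x, rfl⟩, fun x ↦ ?_,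
        fun i x ↦ ?_⟩
      · exact ⟨fun _ ↦ ⟨PUnit.unit, rfl⟩, fun _ ↦ rfl⟩
      · exact ⟨fun _ ↦ ⟨PUnit.unit, rfl⟩, fun _ ↦ rfl⟩
    refine hZ.exists_augment (P := M) 0 (𝟙 M) (fun _ _ _ ↦ rfl) (fun x ↦ ⟨x, rfl⟩) (fun x ↦ ?_) 0
      fun i _ ↦ inferInstanceAs (Subsingleton PUnit.{u + 1})
    exact ⟨fun hx ↦ ⟨PUnit.unit, hx.symm⟩, fun ⟨_, hx⟩ ↦ hx.symm⟩
  | succ n ih =>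
    rcases ModuleCat.enoughProjectives.1 M with ⟨⟨P, f⟩⟩
    have hf : Function.Surjective f := (ModuleCat.epi_iff_surjective f).1 inferInstance
    have hP : Module.Projective S P := (IsProjective.iff_projective P).2 inferInstance
    have T_exact := LinearMap.shortExact_shortComplexKer (f := f.hom) hf
    have : HasProjectiveDimensionLE (ModuleCat.of S (LinearMap.ker f.hom)) n :=
      (T_exact.hasProjectiveDimensionLT_X₃_iff n ‹_›).mp ‹_›
    obtain ⟨C, ε, hC, hn⟩ := ih (ModuleCat.of S (LinearMap.ker f.hom))
    exact hC.exists_augment _ f T_exact.moduleCat_injective_f hf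
      ((ShortComplex.ShortExact.moduleCat_exact_iff_function_exact _).1 T_exact.exact) (n + 1) hn

section

variable {C : ChainComplex (ModuleCat.{u} S) ℕ} {M : ModuleCat.{u} S} {ε : C.X 0 ⟶ M}
  (N : Type u) [AddCommGroup N] [Module S N]

lemma IsFlatResolution.subsingleton_tensorHomology_succ (h : C.IsFlatResolution ε)
    [Module.Flat S N] (i : ℕ) : Subsingleton (C.tensorHomology (i + 1) N) := by
  rw [← ModuleCat.isZero_iff_subsingleton, ← HomologicalComplex.exactAt_iff_isZero_homology,
    HomologicalComplex.exactAt_iff' _ (i + 2) (i + 1) i (by simp) (by simp),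
    ShortComplex.ShortExact.moduleCat_exact_iff_function_exact]
  exact Module.Flat.rTensor_exact N (h.exact_succ i)

lemma subsingleton_tensorHomology_of_subsingleton (i : ℕ) [Subsingleton (C.X i)] :
    Subsingleton (C.tensorHomology i N) := by
  rw [← ModuleCat.isZero_iff_subsingleton, ← HomologicalComplex.exactAt_iff_isZero_homology]
  refine ShortComplex.exact_of_isZero_X₂ _ ?_
  rw [ModuleCat.isZero_iff_subsingleton]
  exact inferInstanceAs (Subsingleton (TensorProduct S (C.X i) N))

/-- Right exactness of the tensor product: both sides are the cokernel of the tensored differential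
from degree `1` to degree `0`. -/
lemma IsFlatResolution.exists_tensorHomology_zero_equiv (h : C.IsFlatResolution ε) :
    Nonempty (C.tensorHomology 0 N ≃ₗ[S] TensorProduct S M N) := by
  let K := C.tensorModule N
  have h₁ : Function.Exact (K.d 1 0) (K.pOpcycles 0) :=
    (ShortComplex.ShortExact.moduleCat_exact_iff_function_exact _).1
      (ShortComplex.exact_of_g_is_cokernel (.mk (K.d 1 0) (K.pOpcycles 0) (K.d_pOpcycles 1 0))
        (K.opcyclesIsCokernel 1 0 (by simp)))
  have h₂ : Function.Surjective (K.pOpcycles 0) :=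
    (ModuleCat.epi_iff_surjective _).1 inferInstance
  have h₃ : Function.Exact (K.d 1 0) (ε.hom.rTensor N) :=
    rTensor_exact N h.exact_zero h.surjective
  have h₄ : Function.Surjective (ε.hom.rTensor N) := LinearMap.rTensor_surjective N h.surjective
  have e₁ : K.homology 0 ≃ₗ[S] K.opcycles 0 := K.isoHomologyι₀.toLinearEquiv
  exact ⟨e₁ ≪≫ₗ ((K.pOpcycles 0).hom.quotKerEquivOfSurjective h₂).symm ≪≫ₗ
    (Submodule.quotEquivOfEq _ _ ((LinearMap.exact_iff.1 h₁).trans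
      (LinearMap.exact_iff.1 h₃).symm)) ≪≫ₗ (ε.hom.rTensor N).quotKerEquivOfSurjective h₄⟩

end

end ChainComplex

end

/-! ### Finiteness of Tor and the Euler characteristic -/

section

open IsLocalRing Module

open FrobeniusPushforward

open CategoryTheory

namespace ChainComplex.IsFlatResolution

variable {S : Type u} [CommRing S] {I : Ideal S} {C : ChainComplex (ModuleCat.{u} S) ℕ}
  {ε : C.X 0 ⟶ ModuleCat.of S (S ⧸ I)} (h : C.IsFlatResolution ε)
include h

lemma exists_tensorHomology_zero_equiv_quotient (N : Type u) [AddCommGroup N] [Module S N] :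
    Nonempty (C.tensorHomology 0 N ≃ₗ[S] N ⧸ (I • ⊤ : Submodule S N)) := by
  obtain ⟨e⟩ := h.exists_tensorHomology_zero_equiv N
  exact ⟨e ≪≫ₗ TensorProduct.quotTensorEquivQuotSMul N I⟩

/-- Dimension shifting: Tor of the flat `P` vanishes in positive degrees. Annihilation and
finiteness of Tor thereby reduce to degree `0`. -/
lemma exists_injective_tensorHomology_succ (i : ℕ) {P N : Type u} [AddCommGroup N] [Module S N]
    [AddCommGroup P] [Module S P] [Module.Flat S P] (g : P →ₗ[S] N) (hg : Function.Surjective g) :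
    ∃ δ : C.tensorHomology (i + 1) N →ₗ[S] C.tensorHomology i (LinearMap.ker g),
      Function.Injective δ := by
  have := h.flat
  obtain ⟨-, -, δ, h₁, -⟩ := C.exists_connecting (LinearMap.ker g).injective_subtype hg
    (LinearMap.exact_subtype_ker_map g)
  refine ⟨δ i, (injective_iff_map_eq_zero _).2 fun x hx ↦ ?_⟩
  obtain ⟨y, rfl⟩ := (h₁ i x).1 hx
  have := h.subsingleton_tensorHomology_succ P i
  rw [Subsingleton.elim y 0, map_zero]

lemma smul_tensorHomology_eq_zero (i : ℕ) (N : Type u) [AddCommGroup N] [Module S N] {a : S}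
    (ha : a ∈ I) (x : C.tensorHomology i N) : a • x = 0 := by
  induction i generalizing N with
  | zero =>
    obtain ⟨e⟩ := h.exists_tensorHomology_zero_equiv_quotient N
    apply e.injective
    rw [map_smul, map_zero]
    obtain ⟨y, hy⟩ := Submodule.mkQ_surjective _ (e x)
    rw [← hy, ← map_smul, Submodule.mkQ_apply, Submodule.Quotient.mk_eq_zero]
    exact Submodule.smul_mem_smul ha trivial
  | succ i ih =>
    obtain ⟨δ, hδ⟩ := h.exists_injective_tensorHomology_succ i
      (Finsupp.linearCombination S (id : N → N)) (Finsupp.linearCombination_id_surjective S N)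
    apply hδ
    rw [map_smul, map_zero, ih]

lemma finite_tensorHomology [IsNoetherianRing S] (i : ℕ) (N : Type u) [AddCommGroup N] [Module S N]
    [Module.Finite S N] : Module.Finite S (C.tensorHomology i N) := by
  induction i generalizing N with
  | zero =>
    obtain ⟨e⟩ := h.exists_tensorHomology_zero_equiv_quotient N
    exact Module.Finite.equiv e.symm
  | succ i ih =>
    obtain ⟨n, g, hg⟩ := Module.Finite.exists_fin' S N
    let g' : ((Fin n → S) : Type u) →ₗ[S] N := g
    obtain ⟨δ, hδ⟩ := h.exists_injective_tensorHomology_succ i g' hg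
    have := ih (LinearMap.ker g')
    exact Module.Finite.of_injective δ hδ

lemma isFiniteLength_tensorHomology [IsNoetherianRing S] [IsLocalRing S] {k : ℕ}
    (hI : maximalIdeal S ^ k ≤ I) (i : ℕ) (N : Type u) [AddCommGroup N] [Module S N]
    [Module.Finite S N] : IsFiniteLength S (C.tensorHomology i N) := by
  have := h.finite_tensorHomology i N
  exact isFiniteLength_of_pow_smul_eq_zero (k := k) fun r hr x ↦
    h.smul_tensorHomology_eq_zero i N (hI hr) x

end ChainComplex.IsFlatResolution

/-- The length of a module as a rational number (zero if the length is infinite). -/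
noncomputable def Module.rationalLength (S : Type u) [CommRing S] (N : Type v) [AddCommGroup N]
    [Module S N] : ℚ :=
  (Module.length S N).toNat

lemma Module.rationalLength_eq_add_range {S : Type u} [CommRing S] {A B D : Type v}
    [AddCommGroup A] [Module S A] [AddCommGroup B] [Module S B] [AddCommGroup D] [Module S D]
    (hB : IsFiniteLength S B) {f : A →ₗ[S] B} {g : B →ₗ[S] D} (hfg : Function.Exact f g) :
    rationalLength S B =
      rationalLength S (LinearMap.range f) + rationalLength S (LinearMap.range g) := by
  have hl := Module.length_eq_add_of_exact (LinearMap.range f).subtype g.rangeRestrict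
    (LinearMap.range f).injective_subtype g.surjective_rangeRestrict (by
      rw [LinearMap.exact_iff, LinearMap.ker_rangeRestrict, Submodule.range_subtype]
      exact LinearMap.exact_iff.1 hfg)
  have hB' := Module.length_ne_top_iff.2 hB
  rw [hl] at hB'
  rw [rationalLength, hl, ENat.toNat_add (fun h ↦ hB' (by simp [h])) (fun h ↦ hB' (by simp [h]))]
  push_cast
  rfl

lemma Module.rationalLength_eq_zero (S : Type u) [CommRing S] (N : Type v) [AddCommGroup N]
    [Module S N] [Subsingleton N] : rationalLength S N = 0 := by
  rw [rationalLength, Module.length_eq_zero]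
  rfl

/-- The alternating sum of the lengths of the homology of the tensor product with a complex. -/
noncomputable def ChainComplex.eulerCharacteristic {S : Type u} [CommRing S]
    (C : ChainComplex (ModuleCat.{u} S) ℕ) (n : ℕ) (N : Type u) [AddCommGroup N] [Module S N] :
    ℚ :=
  ∑ i ∈ Finset.range n, (-1) ^ i * rationalLength S (C.tensorHomology i N)

lemma ChainComplex.IsFlatResolution.isAdditiveOnFinite_eulerCharacteristic {S : Type u}
    [CommRing S] [IsNoetherianRing S] [IsLocalRing S] {I : Ideal S} {k : ℕ}
    (hI : maximalIdeal S ^ k ≤ I) {C : ChainComplex (ModuleCat.{u} S) ℕ}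
    {ε : C.X 0 ⟶ ModuleCat.of S (S ⧸ I)} (h : C.IsFlatResolution ε) (n : ℕ)
    (hn : Subsingleton (C.X n)) :
    IsAdditiveOnFinite S (fun N _ _ ↦ C.eulerCharacteristic n N) := by
  intro N₁ N₂ N₃ _ _ _ _ _ _ _ _ _ f g hf hg hfg
  have := h.flat
  obtain ⟨h₀, h₂, δ, h₃, h₁⟩ := C.exists_connecting hf hg hfg
  have fl (i : ℕ) (N : Type u) [AddCommGroup N] [Module S N] [Module.Finite S N] :=
    h.isFiniteLength_tensorHomology hI i N
  have e₁ (i : ℕ) := rationalLength_eq_add_range (fl i N₁) (h₁ i)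
  have e₂ (i : ℕ) := rationalLength_eq_add_range (fl i N₂) (h₂ i)
  have e₃ (i : ℕ) := rationalLength_eq_add_range (fl (i + 1) N₃) (h₃ i)
  have e₀ : rationalLength S (C.tensorHomology 0 N₃) =
      rationalLength S (LinearMap.range (C.tensorHomologyMap 0 g)) := by
    rw [rationalLength_eq_add_range (fl 0 N₃)
      ((LinearMap.exact_zero_iff_surjective (C.tensorHomology 0 N₃) _).2 h₀), LinearMap.range_zero,
      rationalLength_eq_zero S (⊥ : Submodule S (C.tensorHomology 0 N₃)), add_zero]
  -- Cutting the long exact sequence at degree `m` leaves only the image of the connecting map `δ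
  -- m`, which vanishes once the complex has ended.
  have key (m : ℕ) : C.eulerCharacteristic (m + 1) N₁ + C.eulerCharacteristic (m + 1) N₃ -
      C.eulerCharacteristic (m + 1) N₂ = (-1) ^ m * rationalLength S (LinearMap.range (δ m)) := by
    induction m with
    | zero => simp [eulerCharacteristic, e₁, e₂, e₀]
    | succ m ih =>
      simp only [eulerCharacteristic] at ih ⊢
      simp only [Finset.sum_range_succ _ (m + 1), e₁ (m + 1), e₂ (m + 1), e₃ m, pow_succ]
      linear_combination ih
  dsimp only
  rcases n with _ | n
  · simp [eulerCharacteristic]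
  · have hkey := key n
    have hs := C.subsingleton_tensorHomology_of_subsingleton N₃ (n + 1)
    have : Subsingleton (LinearMap.range (δ n)) :=
      (δ n).surjective_rangeRestrict.subsingleton
    rw [rationalLength_eq_zero, mul_zero] at hkey
    linarith

end

/-! ### Vanishing of Tor and regular sequences -/

section

open IsLocalRing Module

open FrobeniusPushforward

open CategoryTheory

open scoped Pointwise

lemma QuotSMulTop.exact_smul_mkQ {S N : Type*} [CommRing S] [AddCommGroup N] [Module S N] (x : S) :
    Function.Exact (x • LinearMap.id : N →ₗ[S] N) (Submodule.mkQ (x • ⊤ : Submodule S N)) := by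
  rw [LinearMap.exact_iff, Submodule.ker_mkQ]
  ext y
  rw [Submodule.mem_smul_pointwise_iff_exists]
  simp [LinearMap.mem_range]

/-- If the maximal ideal consists of zero divisors on `N`, prime avoidance puts it inside one of the
finitely many associated primes. -/
lemma IsLocalRing.exists_isSMulRegular_or_exists_injective {S N : Type*} [CommRing S]
    [IsLocalRing S] [IsNoetherianRing S] [AddCommGroup N] [Module S N] [Module.Finite S N] :
    (∃ x ∈ maximalIdeal S, IsSMulRegular N x) ∨
      ∃ f : (S ⧸ maximalIdeal S) →ₗ[S] N, Function.Injective f := by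
  by_cases hx : ∃ x ∈ maximalIdeal S, IsSMulRegular N x
  · exact .inl hx
  right
  have hsub : (maximalIdeal S : Set S) ⊆ ⋃ p ∈ associatedPrimes S N, (p : Set S) := by
    rw [biUnion_associatedPrimes_eq_compl_regular]
    intro x hxm hreg
    exact hx ⟨x, hxm, hreg⟩
  have hfin := associatedPrimes.finite S N
  obtain ⟨P, hP, hle⟩ := (Ideal.subset_union_prime_finite hfin (f := id) ⊥ ⊥
    fun P hP _ _ ↦ IsAssociatedPrime.isPrime hP).1 hsub
  have hPm : P = maximalIdeal S :=
    le_antisymm (le_maximalIdeal (IsAssociatedPrime.isPrime hP).ne_top) hle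
  subst hPm
  exact ((isAssociatedPrime_iff_exists_injective_linearMap (M := N) _).1 hP).2

namespace ChainComplex.IsFlatResolution

variable {S : Type u} [CommRing S] [IsLocalRing S] [IsNoetherianRing S] {I : Ideal S}
  {C : ChainComplex (ModuleCat.{u} S) ℕ} {ε : C.X 0 ⟶ ModuleCat.of S (S ⧸ I)}
  (h : C.IsFlatResolution ε) {k : ℕ} (hI : maximalIdeal S ^ k ≤ I)
include h

omit [IsLocalRing S] [IsNoetherianRing S] in
lemma smul_injective_tensorHomology {N : Type u} [AddCommGroup N] [Module S N] {x : S}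
    (hx : IsSMulRegular N x)
    (i : ℕ) [hT : Subsingleton (C.tensorHomology (i + 1) (QuotSMulTop x N))] :
    Function.Injective (x • LinearMap.id : C.tensorHomology i N →ₗ[S] C.tensorHomology i N) := by
  have := h.flat
  obtain ⟨-, -, δ, -, h₁⟩ := C.exists_connecting
    (f := (x • LinearMap.id : N →ₗ[S] N)) (g := (x • ⊤ : Submodule S N).mkQ) (fun _ _ hyz ↦ hx hyz)
    (Submodule.mkQ_surjective _) (QuotSMulTop.exact_smul_mkQ x)
  rw [← tensorHomologyMap_smul_id, injective_iff_map_eq_zero]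
  intro y hy
  obtain ⟨z, rfl⟩ := (h₁ i y).1 hy
  have : z = 0 := hT.elim z 0
  rw [this, map_zero]

omit [IsLocalRing S] [IsNoetherianRing S] in
lemma subsingleton_tensorHomology_quotSMulTop {N : Type u} [AddCommGroup N] [Module S N] {x : S}
    (hx : IsSMulRegular N x)
    (i : ℕ) (h₀ : Subsingleton (C.tensorHomology i N))
    (h₁ : Subsingleton (C.tensorHomology (i + 1) N)) :
    Subsingleton (C.tensorHomology (i + 1) (QuotSMulTop x N)) := by
  have := h.flat
  obtain ⟨-, -, δ, h₂, -⟩ := C.exists_connecting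
    (f := (x • LinearMap.id : N →ₗ[S] N)) (g := (x • ⊤ : Submodule S N).mkQ) (fun _ _ hyz ↦ hx hyz)
    (Submodule.mkQ_surjective _) (QuotSMulTop.exact_smul_mkQ x)
  refine subsingleton_of_forall_eq 0 fun y ↦ ?_
  obtain ⟨z, rfl⟩ := (h₂ i y).1 (h₀.elim _ _)
  rw [h₁.elim z 0, map_zero]

-- Tor is killed by `I`, hence by `x ^ k`; a nilpotent injective endomorphism forces the module to
-- vanish.
omit [IsNoetherianRing S] in
include hI in
lemma subsingleton_tensorHomology_of_smul_injective {N : Type u} [AddCommGroup N] [Module S N]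
    {x : S} (hxm : x ∈ maximalIdeal S) (i : ℕ)
    (hx : Function.Injective
      (x • LinearMap.id : C.tensorHomology i N →ₗ[S] C.tensorHomology i N)) :
    Subsingleton (C.tensorHomology i N) := by
  refine subsingleton_of_forall_eq 0 fun y ↦ ?_
  have key (j : ℕ) : x ^ j • y = 0 → y = 0 := by
    induction j with
    | zero => simp
    | succ j ih =>
      intro hy
      refine ih (hx ?_)
      rw [LinearMap.smul_apply, LinearMap.id_apply, smul_smul, ← pow_succ', hy, map_zero]
  exact key k (h.smul_tensorHomology_eq_zero i N (hI (Ideal.pow_mem_pow hxm k)) y)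

-- Each regular element lowers the vanishing bound by one: if `Tor_(i+1)(N/xN) = 0`, then `x` is
-- injective on `Tor_i(N)`, yet acts nilpotently there.
omit [IsNoetherianRing S] in
include hI in
lemma subsingleton_tensorHomology_of_isWeaklyRegular {s : ℕ}
    (hs : ∀ i, s < i → ∀ (N : Type u) [AddCommGroup N] [Module S N] [Module.Finite S N],
      Subsingleton (C.tensorHomology i N))
    (xs : List S) (hxs : ∀ x ∈ xs, x ∈ maximalIdeal S) (N : Type u) [AddCommGroup N] [Module S N]
    [Module.Finite S N] (hN : RingTheory.Sequence.IsWeaklyRegular N xs) (i : ℕ)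
    (hi : s < i + xs.length) : Subsingleton (C.tensorHomology i N) := by
  induction xs generalizing N i with
  | nil => exact hs i (by simpa using hi) N
  | cons x xs ih =>
    obtain ⟨hx, hN⟩ := (RingTheory.Sequence.isWeaklyRegular_cons_iff N x xs).1 hN
    have := ih (fun y hy ↦ hxs y (by simp [hy])) (QuotSMulTop x N) hN (i + 1)
      (by simp at hi; omega)
    exact h.subsingleton_tensorHomology_of_smul_injective hI (hxs x (by simp)) i
      (h.smul_injective_tensorHomology hx i)

omit [IsLocalRing S] [IsNoetherianRing S] in
lemma subsingleton_tensorHomology_of_injective (i : ℕ) {N N' : Type u} [AddCommGroup N]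
    [Module S N] [AddCommGroup N'] [Module S N'] (f : N →ₗ[S] N') (hf : Function.Injective f)
    [hT : Subsingleton (C.tensorHomology (i + 1) (N' ⧸ LinearMap.range f))]
    [hT' : Subsingleton (C.tensorHomology i N')] : Subsingleton (C.tensorHomology i N) := by
  have := h.flat
  obtain ⟨-, -, δ, -, h₁⟩ := C.exists_connecting hf (Submodule.mkQ_surjective _)
    (LinearMap.exact_map_mkQ_range f)
  refine subsingleton_of_forall_eq 0 fun y ↦ ?_
  obtain ⟨z, rfl⟩ := (h₁ i y).1 (hT'.elim _ _)
  rw [show z = 0 from hT.elim z 0, map_zero]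

omit h [IsLocalRing S] [IsNoetherianRing S] in
lemma subsingleton_tensorHomology_of_equiv (i : ℕ) {N N' : Type u} [AddCommGroup N]
    [Module S N] [AddCommGroup N'] [Module S N'] (f : N ≃ₗ[S] N')
    [hT' : Subsingleton (C.tensorHomology i N')] : Subsingleton (C.tensorHomology i N) := by
  have : Function.Injective (C.tensorHomologyMap i f.toLinearMap) := by
    refine Function.LeftInverse.injective (g := C.tensorHomologyMap i f.symm.toLinearMap)
      fun x ↦ ?_
    rw [← LinearMap.comp_apply, ← tensorHomologyMap_comp, LinearEquiv.symm_comp,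
      tensorHomologyMap_id]
    rfl
  exact this.subsingleton

-- Dévissage to `S / P`. For `P` not maximal, choose `x ∈ m` outside `P`: as Tor vanishes above `s`,
-- `x` acts injectively on `Tor_s(S/P)`, which is therefore zero.
include hI in
lemma subsingleton_tensorHomology_of_residueField {s : ℕ}
    (hs : ∀ i, s < i → ∀ (N : Type u) [AddCommGroup N] [Module S N] [Module.Finite S N],
      Subsingleton (C.tensorHomology i N))
    [hk : Subsingleton (C.tensorHomology s (S ⧸ maximalIdeal S))]
    (N : Type u) [AddCommGroup N] [Module S N] [Module.Finite S N] :
    Subsingleton (C.tensorHomology s N) := by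
  induction ‹Module.Finite S N› using IsNoetherianRing.induction_on_isQuotientEquivQuotientPrime
    with
  | subsingleton N =>
    have : N ≃ₗ[S] PUnit.{u + 1} := LinearEquiv.ofSubsingleton _ _
    -- The identity of `N` is `0 • id`, so the identity on Tor is zero.
    have h0 : (LinearMap.id : N →ₗ[S] N) = 0 := Subsingleton.elim _ _
    have := C.tensorHomologyMap_smul_id (N := N) s 0
    rw [zero_smul, ← h0, tensorHomologyMap_id, zero_smul] at this
    exact subsingleton_of_forall_eq 0 fun y ↦ congr($this y)
  | quotient N P e =>
    suffices Subsingleton (C.tensorHomology s (S ⧸ P.1)) from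
      subsingleton_tensorHomology_of_equiv s e
    by_cases hP : P.1 = maximalIdeal S
    · rwa [hP]
    · obtain ⟨x, hxm, hxP⟩ : ∃ x ∈ maximalIdeal S, x ∉ P.1 := by
        by_contra! hc
        exact hP (le_antisymm (le_maximalIdeal P.2.ne_top) hc)
      have hx : IsSMulRegular (S ⧸ P.1) x := by
        have := P.2
        rw [isSMulRegular_iff_right_eq_zero_of_smul]
        intro y hy
        obtain ⟨y, rfl⟩ := Ideal.Quotient.mk_surjective y
        have hy' : x * y ∈ P.1 := Ideal.Quotient.eq_zero_iff_mem.1 hy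
        exact Ideal.Quotient.eq_zero_iff_mem.2 ((this.mem_or_mem hy').resolve_left hxP)
      have := hs (s + 1) (by omega) (QuotSMulTop x (S ⧸ P.1))
      exact h.subsingleton_tensorHomology_of_smul_injective hI hxm s
        (h.smul_injective_tensorHomology hx s)
  | exact N₁ N₂ N₃ f g hf hg hfg h₁ h₃ =>
    have := h.flat
    obtain ⟨-, h₂, -⟩ := C.exists_connecting hf hg hfg
    refine subsingleton_of_forall_eq 0 fun y ↦ ?_
    obtain ⟨z, rfl⟩ := (h₂ s y).1 (h₃.elim _ _)
    rw [h₁.elim z 0, map_zero]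

-- An Auslander–Buchsbaum argument. Minimality of `s` makes Tor of the residue field nonzero in
-- degree `s`. If the residue field embedded in `N`, its `Tor_s` would embed in `Tor_s(N) = 0`. So
-- `N` has a regular element in `m`, and passing to `N/xN` raises the vanishing range by one degree.
include hI in
lemma exists_isWeaklyRegular {s : ℕ}
    (hs : ∀ i, s < i → ∀ (N : Type u) [AddCommGroup N] [Module S N] [Module.Finite S N],
      Subsingleton (C.tensorHomology i N))
    (hs' : ∀ s', s' < s → ¬ ∀ i, s' < i → ∀ (N : Type u) [AddCommGroup N] [Module S N]
      [Module.Finite S N], Subsingleton (C.tensorHomology i N))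
    (t : ℕ) (ht : t ≤ s) (N : Type u) [AddCommGroup N] [Module S N] [Module.Finite S N]
    (hN : ∀ i, s < i + t → Subsingleton (C.tensorHomology i N)) :
    ∃ xs : List S, (∀ x ∈ xs, x ∈ maximalIdeal S) ∧ xs.length = t ∧
      RingTheory.Sequence.IsWeaklyRegular N xs := by
  induction t generalizing N with
  | zero => exact ⟨[], by simp, rfl, .nil S N⟩
  | succ t ih =>
    rcases IsLocalRing.exists_isSMulRegular_or_exists_injective (S := S) (N := N) with
      ⟨x, hxm, hx⟩ | ⟨f, hf⟩
    · obtain ⟨xs, hxs, hl, hreg⟩ := ih (by omega) (QuotSMulTop x N) fun i hi ↦ by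
        obtain ⟨i, rfl⟩ : ∃ j, i = j + 1 := ⟨i - 1, by omega⟩
        exact h.subsingleton_tensorHomology_quotSMulTop hx i (hN _ (by omega)) (hN _ (by omega))
      exact ⟨x :: xs, by simpa using ⟨hxm, hxs⟩, by simp [hl], .cons hx hreg⟩
    · exfalso
      have := hs (s + 1) (by omega) (N ⧸ LinearMap.range f)
      have := hN s (by omega)
      have := h.subsingleton_tensorHomology_of_injective s f hf
      -- Here `t + 1 ≤ s`, so the subtraction does not truncate.
      refine hs' (s - 1) (by omega) fun i hi N _ _ _ ↦ ?_
      rcases eq_or_lt_of_le (show s ≤ i by omega) with rfl | hi'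
      · exact h.subsingleton_tensorHomology_of_residueField hI hs N
      · exact hs i hi' N

end ChainComplex.IsFlatResolution

end

/-! ### Regular sequences on Frobenius pushforwards -/

section

open IsLocalRing Module

open FrobeniusPushforward

open CategoryTheory

open scoped Pointwise

namespace RingTheory.Sequence.IsWeaklyRegular

lemma of_exact {S : Type v} [CommRing S] {N₁ N₂ N₃ : Type u} [AddCommGroup N₁] [Module S N₁]
    [AddCommGroup N₂] [Module S N₂] [AddCommGroup N₃] [Module S N₃] {f : N₁ →ₗ[S] N₂}
    {g : N₂ →ₗ[S] N₃} (hf : Function.Injective f) (hg : Function.Surjective g)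
    (hfg : Function.Exact f g) {xs : List S} (h₁ : IsWeaklyRegular N₁ xs)
    (h₃ : IsWeaklyRegular N₃ xs) : IsWeaklyRegular N₂ xs := by
  induction xs generalizing N₁ N₂ N₃ with
  | nil => exact .nil S N₂
  | cons x xs ih =>
    rw [isWeaklyRegular_cons_iff] at h₁ h₃ ⊢
    refine ⟨isSMulRegular_of_range_eq_ker hf (LinearMap.exact_iff.1 hfg).symm h₁.1 h₃.1,
      ih (f := QuotSMulTop.map x f) (g := QuotSMulTop.map x g) ?_
        (QuotSMulTop.map_surjective x hg) (QuotSMulTop.map_exact x hfg hg) h₁.2 h₃.2⟩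
    rw [injective_iff_map_eq_zero]
    intro y hy
    obtain ⟨y, rfl⟩ := Submodule.mkQ_surjective _ y
    rw [Submodule.mkQ_apply] at hy ⊢
    rw [QuotSMulTop.map_apply_mk, Submodule.Quotient.mk_eq_zero,
      Submodule.mem_smul_pointwise_iff_exists] at hy
    obtain ⟨z, -, hz⟩ := hy
    have hgz : x • g z = 0 := by rw [← map_smul, hz, hfg.apply_apply_eq_zero]
    obtain ⟨w, rfl⟩ := (hfg z).1 (h₃.1 (hgz.trans (smul_zero x).symm))
    rw [Submodule.Quotient.mk_eq_zero, Submodule.mem_smul_pointwise_iff_exists]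
    exact ⟨w, trivial, hf (by rw [map_smul, hz])⟩

/-- Induction along `0 → N/xN → N/x^(a+2)N → N/x^(a+1)N → 0`, whose first map is multiplication by
`x^(a+1)`. -/
lemma quotSMulTop_pow {S : Type v} [CommRing S] {N : Type u} [AddCommGroup N] [Module S N] {x : S}
    (hx : IsSMulRegular N x) {xs : List S} (h : IsWeaklyRegular (QuotSMulTop x N) xs) (a : ℕ) :
    IsWeaklyRegular (QuotSMulTop (x ^ (a + 1)) N) xs := by
  induction a with
  | zero => rwa [zero_add, pow_one]
  | succ a ih =>
    let f : QuotSMulTop x N →ₗ[S] QuotSMulTop (x ^ (a + 2)) N :=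
      Submodule.mapQ _ _ (x ^ (a + 1) • LinearMap.id) (by
        rintro _ ⟨y, -, rfl⟩
        rw [Submodule.mem_comap, Submodule.mem_smul_pointwise_iff_exists]
        exact ⟨y, trivial, by simp [smul_smul, ← pow_succ']⟩)
    have hle : x ^ (a + 2) • (⊤ : Submodule S N) ≤ x ^ (a + 1) • ⊤ := by
      intro y hy
      rw [Submodule.mem_smul_pointwise_iff_exists] at hy ⊢
      obtain ⟨z, -, rfl⟩ := hy
      exact ⟨x • z, trivial, by rw [smul_smul, ← pow_succ]⟩
    refine of_exact (f := f) (g := Submodule.factor hle) ?_ (Submodule.factor_surjective hle) ?_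
      h ih
    · rw [injective_iff_map_eq_zero]
      intro y hy
      obtain ⟨y, rfl⟩ := Submodule.mkQ_surjective _ y
      have hy' : x ^ (a + 1) • y ∈ x ^ (a + 2) • (⊤ : Submodule S N) :=
        (Submodule.Quotient.mk_eq_zero _).1 hy
      rw [Submodule.mem_smul_pointwise_iff_exists] at hy'
      obtain ⟨z, -, hz⟩ := hy'
      refine (Submodule.Quotient.mk_eq_zero _).2 ?_
      rw [Submodule.mem_smul_pointwise_iff_exists]
      refine ⟨z, trivial, hx.pow (a + 1) ?_⟩
      beta_reduce
      rw [← hz, smul_smul, ← pow_succ]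
    · intro y
      obtain ⟨y, rfl⟩ := Submodule.mkQ_surjective _ y
      constructor
      · intro hy
        have hy' : y ∈ x ^ (a + 1) • (⊤ : Submodule S N) :=
          (Submodule.Quotient.mk_eq_zero _).1 hy
        rw [Submodule.mem_smul_pointwise_iff_exists] at hy'
        obtain ⟨z, -, rfl⟩ := hy'
        exact ⟨Submodule.mkQ _ z, rfl⟩
      · rintro ⟨z, hz⟩
        obtain ⟨z, rfl⟩ := Submodule.mkQ_surjective _ z
        rw [← hz]
        refine (Submodule.Quotient.mk_eq_zero _).2 ?_
        rw [Submodule.mem_smul_pointwise_iff_exists]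
        exact ⟨z, trivial, rfl⟩

/-- On `F^e_* N` the element `x` acts as `x^(p^e)`, so the quotient by `x` is `F^e_*(N / x^(p^e)
N)`; powers of `x` are handled by `quotSMulTop_pow`. -/
lemma frobeniusPushforward {p : ℕ} {S : Type v} [CommRing S] [ExpChar S p] (e : ℕ) {N : Type u}
    [AddCommGroup N] [Module S N] {xs : List S} (h : IsWeaklyRegular N xs) :
    IsWeaklyRegular (FrobeniusPushforward p e N) xs := by
  induction xs generalizing N with
  | nil => exact .nil S _
  | cons x xs ih =>
    rw [isWeaklyRegular_cons_iff] at h ⊢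
    obtain ⟨a, ha⟩ : ∃ a, p ^ e = a + 1 :=
      ⟨p ^ e - 1, (Nat.sub_add_cancel (pow_pos (expChar_pos S p) e)).symm⟩
    refine ⟨h.1.pow (p ^ e), ?_⟩
    have hq := ih (quotSMulTop_pow h.1 h.2 a)
    rw [← ha] at hq
    let g := FrobeniusPushforward.map p e (Submodule.mkQ (x ^ p ^ e • ⊤ : Submodule S N))
    have hg : Function.Surjective g :=
      FrobeniusPushforward.map_surjective p e (Submodule.mkQ_surjective _)
    have hker : x • (⊤ : Submodule S (FrobeniusPushforward p e N)) = LinearMap.ker g := by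
      ext y
      rw [Submodule.mem_smul_pointwise_iff_exists, LinearMap.mem_ker]
      refine Iff.trans ?_ (Submodule.Quotient.mk_eq_zero (x ^ p ^ e • ⊤ : Submodule S N)).symm
      rw [Submodule.mem_smul_pointwise_iff_exists]
      rfl
    exact ((Submodule.quotEquivOfEq _ _ hker).trans
      (g.quotKerEquivOfSurjective hg)).isWeaklyRegular_congr xs |>.2 hq

end RingTheory.Sequence.IsWeaklyRegular

/-- A resolution of finite length of a module that is killed by a power of the maximal ideal stays
exact after a tensor product with a Frobenius pushforward of the ring. -/
lemma ChainComplex.IsFlatResolution.subsingleton_tensorHomology_frobeniusPushforward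
    {S : Type u} [CommRing S] [IsLocalRing S] [IsNoetherianRing S] {p : ℕ} [ExpChar S p]
    {I : Ideal S} {C : ChainComplex (ModuleCat.{u} S) ℕ} {ε : C.X 0 ⟶ ModuleCat.of S (S ⧸ I)}
    (h : C.IsFlatResolution ε) {k : ℕ} (hI : maximalIdeal S ^ k ≤ I) (n : ℕ)
    (hn : ∀ i, n ≤ i → Subsingleton (C.X i)) (e : ℕ)
    [Module.Finite S (FrobeniusPushforward p e S)] (i : ℕ) :
    Subsingleton (C.tensorHomology (i + 1) (FrobeniusPushforward p e S)) := by
  have hex : ∃ s, ∀ i, s < i → ∀ (N : Type u) [AddCommGroup N] [Module S N] [Module.Finite S N],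
      Subsingleton (C.tensorHomology i N) :=
    ⟨n, fun i hi N _ _ _ ↦ by
      have := hn i hi.le
      exact C.subsingleton_tensorHomology_of_subsingleton N i⟩
  classical
  -- Taking `t = s` minimal and `N = S`, whose positive Tor vanishes, produces a weakly regular
  -- sequence of length `s`. On the pushforward it kills Tor in all degrees `i` with `s < i + s`,
  -- that is, `i ≥ 1`.
  obtain ⟨xs, hxs, hl, hreg⟩ := h.exists_isWeaklyRegular hI (Nat.find_spec hex)
    (fun s' hs' ↦ Nat.find_min hex hs') (Nat.find hex) le_rfl S fun i hi ↦ by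
      obtain ⟨i, rfl⟩ : ∃ j, i = j + 1 := ⟨i - 1, by omega⟩
      exact h.subsingleton_tensorHomology_succ S i
  exact h.subsingleton_tensorHomology_of_isWeaklyRegular hI (Nat.find_spec hex) xs hxs _
    (hreg.frobeniusPushforward e) (i + 1) (by omega)

end

/-! ### Frobenius powers as Euler characteristics, and descent from the completion -/

section

open IsLocalRing Module

open FrobeniusPushforward

open CategoryTheory

open scoped Pointwise TensorProduct

/-- The quotient is `F^e_*(S / J^[p^e])`, and over a perfect residue field the pushforward preserves
length. -/
lemma FrobeniusPushforward.length_quotient_smul_top {S : Type u} [CommRing S] [IsLocalRing S]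
    [IsNoetherianRing S] {p : ℕ} [Fact p.Prime] [CharP S p] [ExpChar S p]
    [PerfectField (ResidueField S)] {J : Ideal S} {k : ℕ} (hJ : maximalIdeal S ^ k ≤ J) (e : ℕ) :
    Module.length S (FrobeniusPushforward p e S ⧸
      (J • ⊤ : Submodule S (FrobeniusPushforward p e S))) =
    Module.length S (S ⧸ J.frobeniusPower p e) := by
  let g := FrobeniusPushforward.map p e (Submodule.mkQ (J.frobeniusPower p e))
  have hg : Function.Surjective g :=
    FrobeniusPushforward.map_surjective p e (Submodule.mkQ_surjective _)
  have hmem (y : FrobeniusPushforward p e S) :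
      y ∈ LinearMap.ker g ↔ (of p e S).symm y ∈ J.frobeniusPower p e :=
    Submodule.Quotient.mk_eq_zero (J.frobeniusPower p e)
  have hker : (J • ⊤ : Submodule S (FrobeniusPushforward p e S)) = LinearMap.ker g := by
    apply le_antisymm
    · refine Submodule.smul_le.2 fun r hr y _ ↦ (hmem _).2 ?_
      rw [of_symm_smul]
      exact Ideal.mul_mem_right _ _ (J.pow_mem_frobeniusPower p e hr)
    · intro y hy
      rw [hmem] at hy
      suffices ∀ z ∈ J.frobeniusPower p e,
          of p e S z ∈ (J • ⊤ : Submodule S (FrobeniusPushforward p e S)) by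
        simpa using this _ hy
      intro z hz
      refine Submodule.span_induction (p := fun z _ ↦
        of p e S z ∈ (J • ⊤ : Submodule S (FrobeniusPushforward p e S))) ?_ ?_ ?_ ?_ hz
      · rintro _ ⟨a, ha, rfl⟩
        have := Submodule.smul_mem_smul (N := (⊤ : Submodule S (FrobeniusPushforward p e S))) ha
          (Submodule.mem_top (x := of p e S 1))
        simpa using this
      · simp
      · intro x y _ _ hx hy
        rw [map_add]
        exact add_mem hx hy
      · intro c x _ hx
        let m : FrobeniusPushforward p e S →ₗ[S] FrobeniusPushforward p e S :=
          FrobeniusPushforward.map p e (LinearMap.mulLeft S c)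
        have := Submodule.mem_map_of_mem (f := m) hx
        rw [Submodule.map_smul''] at this
        exact Submodule.smul_mono le_rfl le_top this
  rw [((Submodule.quotEquivOfEq _ _ hker).trans (g.quotKerEquivOfSurjective hg)).length_eq]
  obtain ⟨l, hl⟩ := J.exists_pow_le_frobeniusPower p e (m := maximalIdeal S)
    fun x hx ↦ ⟨k, hJ (Ideal.pow_mem_pow hx k)⟩
  exact FrobeniusPushforward.length_eq p S e (isFiniteLength_quotient_of_pow_le hl)

/-- The lengths of the quotients by the Frobenius powers of an ideal of finite colength and finite
projective dimension are given by a polynomial. -/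
theorem IsLocalRing.exists_polynomial_rationalLength_quotient_frobeniusPower {S : Type u}
    [CommRing S] [IsLocalRing S] [IsNoetherianRing S] (p : ℕ) [Fact p.Prime] [CharP S p]
    [ExpChar S p] [IsFFinite p S] [PerfectField (ResidueField S)] {J : Ideal S} {k : ℕ}
    (hJ : maximalIdeal S ^ k ≤ J) (n : ℕ)
    [HasProjectiveDimensionLE (ModuleCat.of S (S ⧸ J)) n] :
    ∃ P : Polynomial ℚ, ∀ e : ℕ,
      rationalLength S (S ⧸ J.frobeniusPower p e) = P.eval ((p : ℚ) ^ e) := by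
  obtain ⟨C, ε, hC, hn⟩ := ChainComplex.exists_isFlatResolution_of_hasProjectiveDimensionLE n
    (ModuleCat.of S (S ⧸ J))
  obtain ⟨P, hP⟩ := (hC.isAdditiveOnFinite_eulerCharacteristic hJ (n + 1)
    (hn _ le_rfl)).exists_polynomial_pushforward p S
  refine ⟨P, fun e ↦ ?_⟩
  rw [← hP e, ChainComplex.eulerCharacteristic, Finset.sum_range_succ']
  have hfin : Module.Finite S (FrobeniusPushforward p e S) :=
    IsFFinite.finite_pushforward p (R := S) S e
  rw [Finset.sum_eq_zero, zero_add, pow_zero, one_mul]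
  · obtain ⟨f⟩ := hC.exists_tensorHomology_zero_equiv_quotient (FrobeniusPushforward p e S)
    rw [rationalLength, rationalLength, f.length_eq, length_quotient_smul_top hJ]
  · intro i _
    have := hC.subsingleton_tensorHomology_frobeniusPushforward (p := p) hJ (n + 1) hn e i
    rw [rationalLength_eq_zero, mul_zero]

/-- Flat base change keeps a first-syzygy sequence exact and its middle term projective, so the
dimension drops by one on both sides. -/
lemma ModuleCat.hasProjectiveDimensionLE_baseChange {R S : Type u} [CommRing R] [CommRing S]
    [Algebra R S] [Module.Flat R S] (n : ℕ) (M : Type u) [AddCommGroup M] [Module R M]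
    [HasProjectiveDimensionLE (ModuleCat.of R M) n] :
    HasProjectiveDimensionLE (ModuleCat.of S (S ⊗[R] M)) n := by
  induction n generalizing M with
  | zero =>
    have projle : HasProjectiveDimensionLE (ModuleCat.of R M) 0 := ‹_›
    simp only [HasProjectiveDimensionLE, zero_add] at projle ⊢
    rw [← projective_iff_hasProjectiveDimensionLT_one, ← IsProjective.iff_projective] at projle ⊢
    exact inferInstanceAs (Module.Projective S (S ⊗[R] M))
  | succ n ih =>
    obtain ⟨P, _, _, hP, f, hf⟩ : ∃ (P : Type u) (_ : AddCommGroup P) (_ : Module R P)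
        (_ : Module.Projective R P) (f : P →ₗ[R] M), Function.Surjective f :=
      ⟨M →₀ R, _, _, inferInstance, _, Finsupp.linearCombination_id_surjective R M⟩
    have hK : HasProjectiveDimensionLE (ModuleCat.of R (LinearMap.ker f)) n :=
      ((LinearMap.shortExact_shortComplexKer hf).hasProjectiveDimensionLT_X₃_iff n
        ((IsProjective.iff_projective P).1 hP)).mp ‹_›
    obtain ⟨K, _, _, i, hi, hif, hK⟩ : ∃ (K : Type u) (_ : AddCommGroup K) (_ : Module R K)
        (i : K →ₗ[R] P), Function.Injective i ∧ Function.Exact i f ∧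
        HasProjectiveDimensionLE (ModuleCat.of R K) n :=
      ⟨LinearMap.ker f, _, _, (LinearMap.ker f).subtype, (LinearMap.ker f).injective_subtype,
        LinearMap.exact_subtype_ker_map f, hK⟩
    have hex : Function.Exact (i.baseChange S) (f.baseChange S) := lTensor_exact S hif hf
    have hT := ModuleCat.shortComplex_shortExact
      (ShortComplex.mk (ModuleCat.ofHom (i.baseChange S)) (ModuleCat.ofHom (f.baseChange S)) (by
        rw [← ModuleCat.ofHom_comp, hex.linearMap_comp_eq_zero]; rfl)) hex
        (Module.Flat.lTensor_preserves_injective_linearMap (M := S) i hi)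
        (LinearMap.lTensor_surjective S hf)
    exact (hT.hasProjectiveDimensionLT_X₃_iff n
      ((IsProjective.iff_projective (R := S) (S ⊗[R] P)).1 inferInstance)).mpr (ih K)

lemma Ideal.hasProjectiveDimensionLE_quotient {R : Type u} [CommRing R] (I : Ideal R) (n : ℕ)
    [HasProjectiveDimensionLE (ModuleCat.of R I) n] :
    HasProjectiveDimensionLE (ModuleCat.of R (R ⧸ I)) (n + 1) := by
  have hex : Function.Exact (Submodule.subtype I) (Submodule.mkQ I) :=
    LinearMap.exact_subtype_mkQ I
  have hT := ModuleCat.shortComplex_shortExact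
    (ShortComplex.mk (ModuleCat.ofHom (Submodule.subtype I)) (ModuleCat.ofHom (Submodule.mkQ I)) (by
      rw [← ModuleCat.ofHom_comp, hex.linearMap_comp_eq_zero]; rfl)) hex
      (Submodule.injective_subtype I) (Submodule.mkQ_surjective I)
  have hP : Projective (ModuleCat.of R R) :=
    (IsProjective.iff_projective (R := R) R).1 inferInstance
  exact (hT.hasProjectiveDimensionLT_X₃_iff n hP).mpr ‹_›

end

open IsLocalRing Module CategoryTheory

theorem corollary3p2 {R : Type*} [CommRing R] [IsLocalRing R] [IsNoetherianRing R]
    (p : ℕ) [Fact p.Prime] [CharP R p] [PerfectField (IsLocalRing.ResidueField R)]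
    (I : Ideal R) (hprimary : I.IsPrimary)
    (hradical : I.radical = IsLocalRing.maximalIdeal R)
    (hpd : CategoryTheory.projectiveDimension (ModuleCat.of R I) ≠ ⊤) :
    ∃ P : Polynomial ℚ, ∀ e : ℕ,
      hilbertKunz I p e ≠ ⊤ ∧
        ((hilbertKunz I p e).toNat : ℚ) = P.eval ((p : ℚ) ^ e) := by
  -- The completion supplies `F`-finiteness while keeping the residue field perfect and the lengths
  -- unchanged.
  let S := AdicCompletion (maximalIdeal R) R
  let J : Ideal S := I.map (algebraMap R S)
  have : ExpChar R p := .prime Fact.out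
  have : CharP S p := AdicCompletion.charP_self p
  have : ExpChar S p := .prime Fact.out
  have : PerfectField (ResidueField S) := AdicCompletion.perfectField_residueField R
  have : IsFFinite p S := IsFFinite.of_isAdicComplete p S
  obtain ⟨n, hn⟩ := (projectiveDimension_ne_top_iff _).1 hpd
  have := Ideal.hasProjectiveDimensionLE_quotient I n
  have := ModuleCat.hasProjectiveDimensionLE_baseChange (R := R) (S := S) (n + 1) (R ⧸ I)
  have : HasProjectiveDimensionLE (ModuleCat.of S (S ⧸ J)) (n + 1) :=
    hasProjectiveDimensionLT_of_iso (I.qoutMapEquivTensorQout S).symm.toModuleIso _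
  have hpow (e : ℕ) : ∃ k, maximalIdeal R ^ k ≤ I.frobeniusPower p e :=
    I.exists_pow_le_frobeniusPower p e hradical.ge
  obtain ⟨k, hk⟩ := Ideal.exists_pow_le_of_le_radical_of_fg hradical.ge
    (IsNoetherian.noetherian (maximalIdeal R))
  have hJ : maximalIdeal S ^ k ≤ J := by
    rw [AdicCompletion.maximalIdeal_eq_map, ← Ideal.map_pow]
    exact Ideal.map_mono hk
  obtain ⟨P, hP⟩ :=
    IsLocalRing.exists_polynomial_rationalLength_quotient_frobeniusPower p hJ (n + 1)
  refine ⟨P, fun e ↦ ?_⟩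
  obtain ⟨l, hl⟩ := hpow e
  refine ⟨Module.length_ne_top_iff.2 (isFiniteLength_quotient_of_pow_le hl), ?_⟩
  rw [← hP e, rationalLength, Ideal.frobeniusPower_map, AdicCompletion.length_quotient_map hl]
  rfl
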